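/- Let $\lambda_0,\dots,\lambda_4\in\mathbb C$, let $f(x,y)=y^4-(x^5+\lambda_4x^4+\lambda_3x^3+\lambda_2x^2+\lambda_1x+\lambda_0)$, and assume that the affine curve $f=0$ is nonsingular. Let $C$ be the compact Riemann surface (of genus $6$) obtained from it by adding its unique point $\infty$ at infinity. Put $du_j=\dfrac{g_j(x,y)}{4y^3}\,dx$ with $(g_1,\dots,g_6)=(1,\,x,\,y,\,x^2,\,xy,\,y^2)$, and $dr_j=\dfrac{h_j(x,y)}{4y^3}\,dx$ with $$h_1=y^2(11x^3+8\lambda_4x^2+5\lambda_3x+2\lambda_2),\quad h_2=y^2(7x^2+4\lambda_4x+\lambda_3),\quad h_3=2xy(3x^2+2\lambda_4x+\lambda_3),$$ $$h_4=3xy^2,\quad h_5=2x^2y,\quad h_6=x^3.$$ For points $(x,y),(z,w)$ of $C$ let $$\Sigma\big((x,y),(z,w)\big)=\frac{1}{4y^3(x-z)}\sum_{k=1}^4y^{4-k}\left[\frac{f(z,w)}{w^{4-k+1}}\right]_w,$$ where $f(z,w)$ is regarded as a polynomial in the independent variables $z,w$ and $[\ ]_w$ means that all terms with negative powers of $w$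 are removed. Let $$R\big((x,y),(z,w)\big)=\frac{\partial}{\partial z}\Sigma\big((x,y),(z,w)\big)+\sum_{j=1}^6\frac{du_j(x,y)}{dx}\cdot\frac{dr_j(z,w)}{dz},\qquad \Omega\big((x,y),(z,w)\big)=R\big((x,y),(z,w)\big)\,dx\,dz,$$ where $\partial/\partial z$ is taken along the curve, that is, with $w$ depending on $z$ through $f(z,w)=0$. Then: 1. Each $dr_j$ is holomorphic on $C\setminus\{\infty\}$, and every nontrivial linear combination of $dr_1,\dots,dr_6$ has a pole at $\infty$. 2. $\Omega$ is a fundamental differential of the second kind on $C\times C$: it is symmetric, $\Omega\big((x,y),(z,w)\big)=\Omega\big((z,w),(x,y)\big)$; it is holomorphic on $C\times C$ outside the diagonal; and for every point of $C$ and every local coordinate $\xi$ of $C$ centred there, with $\xi,\xi'$ the coordinates of $(x,y),(z,w)$, $$\Omega\big((x,y),(z,w)\big)=\left(\frac1{(\xi-\xi')^2}+O(1)\right)d\xi\,d\xi'$$ near that point of the diagonal, the term $O(1)$ being holomorphic. 3. We have $$\Omega\big((x,y),(z,w)\big)=\frac{F\big((x,y),(z,w)\big)\,dx\,dz}{(x-z)^2f_y(x,y)f_w(z,w)},$$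 where $F$ is the polynomial, symmetric under $(x,y)\leftrightarrow(z,w)$, $$\begin{aligned}F&=4y^3w^3+\big(3xz^4+\lambda_3z^3+x^2z^3+2\lambda_2z^2+3\lambda_3xz^2+4\lambda_4xz^3+4\lambda_0+\lambda_1x+2\lambda_2xz+3\lambda_1z\big)y^2\\ &\quad+\big(2\lambda_1z+4\lambda_2xz+4\lambda_0+2\lambda_1x+4\lambda_4x^2z^2+2\lambda_3x^2z+2x^3z^2+2x^2z^3+2\lambda_3xz^2\big)wy\\ &\quad+\big(\lambda_3x^3+4\lambda_0+3\lambda_1x+2\lambda_2x^2+\lambda_1z+x^3z^2+3x^4z+2\lambda_2xz+3\lambda_3x^2z+4\lambda_4x^3z\big)w^2.\end{aligned}$$ -/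

import Mathlib

open Filter Topology Polynomial

/-- The quintic `x⁵ + λ₄x⁴ + λ₃x³ + λ₂x² + λ₁x + λ₀`; `lam i` is `λ_i`. -/
noncomputable def quintic (lam : Fin 5 → ℂ) : ℂ[X] :=
  X ^ 5 + C (lam 4) * X ^ 4 + C (lam 3) * X ^ 3 + C (lam 2) * X ^ 2 + C (lam 1) * X + C (lam 0)

/-- `f(x,y) = y⁴ - (x⁵ + ⋯ + λ₀)` as a polynomial in `y` with coefficients in `ℂ[x]`. -/
noncomputable def fPoly (lam : Fin 5 → ℂ) : ℂ[X][X] :=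
  X ^ 4 - C (quintic lam)

/-- The value `f(x,y)` at `P = (x,y)`. -/
noncomputable def curveEq (lam : Fin 5 → ℂ) (P : ℂ × ℂ) : ℂ := (fPoly lam).evalEval P.1 P.2

/-- `∂f/∂x`. -/
noncomputable def curveEqX (lam : Fin 5 → ℂ) (P : ℂ × ℂ) : ℂ := deriv (fun x => curveEq lam (x, P.2)) P.1

/-- `∂f/∂y`. -/
noncomputable def curveEqY (lam : Fin 5 → ℂ) (P : ℂ × ℂ) : ℂ := deriv (fun y => curveEq lam (P.1, y)) P.2

/-- The affine curve `f = 0` is nonsingular (so that its compactification `C` has genus `6`). -/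
def IsNonsingular (lam : Fin 5 → ℂ) : Prop :=
  ∀ P : ℂ × ℂ, curveEq lam P = 0 → curveEqX lam P ≠ 0 ∨ curveEqY lam P ≠ 0

/-- The points of the compact curve `C`: the affine points and the unique point at infinity. -/
inductive CurvePoint (lam : Fin 5 → ℂ) : Type
  | affine (P : ℂ × ℂ) (hP : curveEq lam P = 0) : CurvePoint lam
  | infinity : CurvePoint lam

/-- `γ t = (x(t), y(t))` is the inverse of a local coordinate of `C` centred at the given point:
a parametrisation of `C` near that point by the values `t` (near `0`) of the coordinate.
At an affine point `P` it is a holomorphic immersed arc on the curve with `γ 0 = P`.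
At infinity, `x` and `y` are meromorphic in `t`, and `x`, which has a pole of order exactly four at
the point at infinity of `C`, has a pole of order four in `t`; `γ 0` is irrelevant there. -/
def IsLocalParam (lam : Fin 5 → ℂ) : CurvePoint lam → (ℂ → ℂ × ℂ) → Prop
  | .affine P _, γ =>
      AnalyticAt ℂ γ 0 ∧ γ 0 = P ∧ deriv γ 0 ≠ 0 ∧ ∀ᶠ t in 𝓝 0, curveEq lam (γ t) = 0
  | .infinity, γ =>
      MeromorphicAt (fun t => (γ t).1) 0 ∧ MeromorphicAt (fun t => (γ t).2) 0 ∧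
      meromorphicOrderAt (fun t => (γ t).1) 0 = -4 ∧ ∀ᶠ t in 𝓝[≠] 0, curveEq lam (γ t) = 0

/-- The coefficient of `dt` in the pull-back along `γ` of the differential `φ(x,y) dx`. -/
noncomputable def pullback (φ : ℂ × ℂ → ℂ) (γ : ℂ → ℂ × ℂ) (t : ℂ) : ℂ :=
  φ (γ t) * deriv (fun t' => (γ t').1) t

/-- The differential `φ(x,y) dx` on `C` is holomorphic at `p` (after removing a removable
singularity of the coefficient). -/
def IsHolomorphicDiffAt (lam : Fin 5 → ℂ) (φ : ℂ × ℂ → ℂ) (p : CurvePoint lam) : Prop :=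
  ∀ γ, IsLocalParam lam p γ →
    ∃ H : ℂ → ℂ, AnalyticAt ℂ H 0 ∧ ∀ᶠ t in 𝓝[≠] 0, pullback φ γ t = H t

/-- The differential `φ(x,y) dx` on `C` is meromorphic at `p` and has a pole there. -/
def HasPoleDiffAt (lam : Fin 5 → ℂ) (φ : ℂ × ℂ → ℂ) (p : CurvePoint lam) : Prop :=
  ∀ γ, IsLocalParam lam p γ →
    MeromorphicAt (pullback φ γ) 0 ∧ meromorphicOrderAt (pullback φ γ) 0 < 0

/-- The coefficient of `ds dt` in the pull-back along `γ × δ` of the 2-form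
`R((x,y),(z,w)) dx dz`. -/
noncomputable def pullback₂ (R : ℂ × ℂ → ℂ × ℂ → ℂ) (γ δ : ℂ → ℂ × ℂ) (s t : ℂ) : ℂ :=
  R (γ s) (δ t) * deriv (fun s' => (γ s').1) s * deriv (fun t' => (δ t').1) t

/-- Pairs `((x,y),(z,w))` at which none of the denominators `x - z`, `y`, `w` vanishes. The
coefficients of the 2-forms below are given by formulas on this dense set of pairs. -/
def Generic (P Q : ℂ × ℂ) : Prop := P.1 ≠ Q.1 ∧ P.2 ≠ 0 ∧ Q.2 ≠ 0

/-- `Ω = R((x,y),(z,w)) dx dz` is a fundamental differential of the second kind on `C × C`: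
it is symmetric, it extends holomorphically to `C × C` minus the diagonal, and near each diagonal
point it is `(1/(ξ - ξ')² + O(1)) dξ dξ'` for every local coordinate `ξ`, the remainder `O(1)`
being holomorphic. -/
structure IsFundamentalDifferential (lam : Fin 5 → ℂ) (R : ℂ × ℂ → ℂ × ℂ → ℂ) : Prop where
  symmetric : ∀ P Q, curveEq lam P = 0 → curveEq lam Q = 0 → Generic P Q → R P Q = R Q P
  offDiagonal : ∀ (p q : CurvePoint lam), p ≠ q → ∀ γ δ : ℂ → ℂ × ℂ,
    IsLocalParam lam p γ → IsLocalParam lam q δ →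
    ∃ H : ℂ × ℂ → ℂ, AnalyticAt ℂ H (0, 0) ∧ ∀ᶠ u : ℂ × ℂ in 𝓝 (0, 0),
      u.1 ≠ 0 → u.2 ≠ 0 → Generic (γ u.1) (δ u.2) → pullback₂ R γ δ u.1 u.2 = H u
  diagonal : ∀ (p : CurvePoint lam) (γ : ℂ → ℂ × ℂ), IsLocalParam lam p γ →
    ∃ H : ℂ × ℂ → ℂ, AnalyticAt ℂ H (0, 0) ∧ ∀ᶠ u : ℂ × ℂ in 𝓝 (0, 0),
      u.1 ≠ 0 → u.2 ≠ 0 → Generic (γ u.1) (γ u.2) →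
        pullback₂ R γ γ u.1 u.2 = 1 / (u.1 - u.2) ^ 2 + H u

/-- The numerators `g₁, …, g₆` of the holomorphic differentials `du_j = g_j dx / (4y³)`. -/
def gNum (j : Fin 6) (P : ℂ × ℂ) : ℂ :=
  ![1, P.1, P.2, P.1 ^ 2, P.1 * P.2, P.2 ^ 2] j

/-- `du_j / dx`. -/
noncomputable def duCoeff (j : Fin 6) (P : ℂ × ℂ) : ℂ := gNum j P / (4 * P.2 ^ 3)

/-- The numerators `h₁, …, h₆` of the meromorphic differentials `dr_j = h_j dx / (4y³)`. -/
def hNum (lam : Fin 5 → ℂ) (j : Fin 6) (P : ℂ × ℂ) : ℂ :=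
  ![P.2 ^ 2 * (11 * P.1 ^ 3 + 8 * lam 4 * P.1 ^ 2 + 5 * lam 3 * P.1 + 2 * lam 2),
    P.2 ^ 2 * (7 * P.1 ^ 2 + 4 * lam 4 * P.1 + lam 3),
    2 * P.1 * P.2 * (3 * P.1 ^ 2 + 2 * lam 4 * P.1 + lam 3),
    3 * P.1 * P.2 ^ 2,
    2 * P.1 ^ 2 * P.2,
    P.1 ^ 3] j

/-- `dr_j / dx`. -/
noncomputable def drCoeff (lam : Fin 5 → ℂ) (j : Fin 6) (P : ℂ × ℂ) : ℂ :=
  hNum lam j P / (4 * P.2 ^ 3)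

/-- `[f(z,w) / w^m]_w`, the terms with negative powers of `w` being removed. One application of
`divX` subtracts one from each exponent of `w` and drops the term with exponent `0`. -/
noncomputable def truncDiv (lam : Fin 5 → ℂ) (m : ℕ) (Q : ℂ × ℂ) : ℂ :=
  (divX^[m] (fPoly lam)).evalEval Q.1 Q.2

/-- The meromorphic function `Σ((x,y),(z,w))`, with `P = (x,y)` and `Q = (z,w)`. -/
noncomputable def Sig (lam : Fin 5 → ℂ) (P Q : ℂ × ℂ) : ℂ :=
  1 / (4 * P.2 ^ 3 * (P.1 - Q.1)) *
    ∑ k ∈ Finset.Icc 1 4, P.2 ^ (4 - k) * truncDiv lam (4 - k + 1) Q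

/-- The derivative `∂G/∂z` at `Q = (z,w)` of a function `G(z,w)` on the curve, where `w` depends on
`z` through `f(z,w) = 0`, so `dw/dz = -f_z/f_w`. -/
noncomputable def curveDeriv (lam : Fin 5 → ℂ) (G : ℂ × ℂ → ℂ) (Q : ℂ × ℂ) : ℂ :=
  fderiv ℂ G Q (1, -curveEqX lam Q / curveEqY lam Q)

/-- `R = ∂Σ/∂z + ∑_j (du_j/dx)(dr_j/dz)`. -/
noncomputable def coeffR (lam : Fin 5 → ℂ) (P Q : ℂ × ℂ) : ℂ :=
  curveDeriv lam (Sig lam P) Q + ∑ j : Fin 6, duCoeff j P * drCoeff lam j Q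

/-- The polynomial `F((x,y),(z,w))`. -/
def polyF (lam : Fin 5 → ℂ) (P Q : ℂ × ℂ) : ℂ :=
  let x := P.1
  let y := P.2
  let z := Q.1
  let w := Q.2
  4 * y ^ 3 * w ^ 3
  + (3 * x * z ^ 4 + lam 3 * z ^ 3 + x ^ 2 * z ^ 3 + 2 * lam 2 * z ^ 2 + 3 * lam 3 * x * z ^ 2
      + 4 * lam 4 * x * z ^ 3 + 4 * lam 0 + lam 1 * x + 2 * lam 2 * x * z + 3 * lam 1 * z) * y ^ 2
  + (2 * lam 1 * z + 4 * lam 2 * x * z + 4 * lam 0 + 2 * lam 1 * x + 4 * lam 4 * x ^ 2 * z ^ 2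
      + 2 * lam 3 * x ^ 2 * z + 2 * x ^ 3 * z ^ 2 + 2 * x ^ 2 * z ^ 3
      + 2 * lam 3 * x * z ^ 2) * w * y
  + (lam 3 * x ^ 3 + 4 * lam 0 + 3 * lam 1 * x + 2 * lam 2 * x ^ 2 + lam 1 * z + x ^ 3 * z ^ 2
      + 3 * x ^ 4 * z + 2 * lam 2 * x * z + 3 * lam 3 * x ^ 2 * z
      + 4 * lam 4 * x ^ 3 * z) * w ^ 2

/-! Write q for the quintic, so that the curve is y⁴ = q(x). The truncations give Σ = (y³ + y²w +
yw² + w³)/(4y³(x - z)). Differentiating with dw/dz = q'(z)/(4w³) and reducing modulo w⁴ = q(z)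
yields the closed form F/((x - z)² f_y f_w) (`coeffR_eq`, `polyF_eq`); the symmetry of Ω is then
that of F.

Poles are examined chart by chart. On the affine curve dx/(4y³) is holomorphic, since it equals
dy/q'(x) near the branch points y = 0, where nonsingularity gives q'(x) ≠ 0. So for two affine
points only x = z is dangerous, and there `polyF_mul_sq` trades (x - z)² for (y - w)², which is
harmless when y ≠ w. At infinity T = x/y is a coordinate and v = 1/x satisfies v = T⁴(1 + λ₄v + ⋯ +
λ₀v⁵); `polyF_mixed` settles pairs with one point at infinity, and `polyF_infinity` produces the
denominator (T - U)² when both points are near infinity.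

Near a diagonal point these charts make N = (ξ - ξ')²Ω analytic. Since F(P,P) = f_y(P)², N is 1 on
the diagonal, and the symmetry of N kills the first-order term transverse to it. Hence N - 1 is
divisible by (ξ - ξ')² (`AnalyticAt.exists_eq_one_add_sq_mul`); values are only ever computed at
points where x is a coordinate and y ≠ 0.

Finally, dr₁, …, dr₆ have poles of orders 12, 8, 7, 4, 3, 2 at infinity. These are distinct, so
leading terms of a linear combination cannot cancel. -/

/-! ### The closed form of Σ and of R -/

theorem curveEq_eq (lam : Fin 5 → ℂ) (P : ℂ × ℂ) :
    curveEq lam P = P.2 ^ 4 - (quintic lam).eval P.1 := by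
  simp [curveEq, fPoly, evalEval]

theorem quintic_eval (lam : Fin 5 → ℂ) (x : ℂ) :
    (quintic lam).eval x =
      x ^ 5 + lam 4 * x ^ 4 + lam 3 * x ^ 3 + lam 2 * x ^ 2 + lam 1 * x + lam 0 := by
  simp [quintic]

theorem quintic_derivative_eval (lam : Fin 5 → ℂ) (x : ℂ) :
    (quintic lam).derivative.eval x =
      5 * x ^ 4 + 4 * lam 4 * x ^ 3 + 3 * lam 3 * x ^ 2 + 2 * lam 2 * x + lam 1 := by
  simp [quintic]
  ring

theorem curveEqX_eq (lam : Fin 5 → ℂ) (P : ℂ × ℂ) :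
    curveEqX lam P = -(quintic lam).derivative.eval P.1 := by
  simp [curveEqX, curveEq_eq]

theorem curveEqY_eq (lam : Fin 5 → ℂ) (P : ℂ × ℂ) : curveEqY lam P = 4 * P.2 ^ 3 := by
  simp [curveEqY, curveEq_eq]

theorem divX_pow_succ_add_C {R : Type*} [CommRing R] (n : ℕ) (a : R) :
    divX ((X : R[X]) ^ (n + 1) + C a) = X ^ n := by
  ext m
  simp [coeff_X_pow]

/-- Since f is w⁴ plus a term free of w, the first division by w removes that term, and the
truncation of f/wᵐ is w⁴⁻ᵐ for 1 ≤ m ≤ 4. -/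
theorem Sig_eq (lam : Fin 5 → ℂ) (P Q : ℂ × ℂ) :
    Sig lam P Q = (P.2 ^ 3 + P.2 ^ 2 * Q.2 + P.2 * Q.2 ^ 2 + Q.2 ^ 3) /
      (4 * P.2 ^ 3 * (P.1 - Q.1)) := by
  have e : fPoly lam = X ^ (3 + 1) + C (-quintic lam) := by simp [fPoly, sub_eq_add_neg]
  have h1 : divX^[1] (fPoly lam) = X ^ 3 := by
    rw [e, Function.iterate_one, divX_pow_succ_add_C]
  have h (n : ℕ) : divX ((X : ℂ[X][X]) ^ (n + 1)) = X ^ n := by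
    simpa using divX_pow_succ_add_C n (0 : ℂ[X])
  have h2 : divX^[2] (fPoly lam) = X ^ 2 := by
    rw [Function.iterate_succ_apply' divX 1, h1, h]
  have h3 : divX^[3] (fPoly lam) = X ^ 1 := by
    rw [Function.iterate_succ_apply' divX 2, h2, h]
  have h4 : divX^[4] (fPoly lam) = X ^ 0 := by
    rw [Function.iterate_succ_apply' divX 3, h3, h]
  have s : Finset.Icc 1 4 = {1, 2, 3, 4} := by decide
  rw [Sig, s]
  simp only [truncDiv, Finset.mem_insert, Finset.mem_singleton, OfNat.one_ne_ofNat, or_self,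
    not_false_eq_true, Finset.sum_insert, Finset.sum_singleton, Nat.reduceEqDiff, Nat.reduceSub,
    Nat.reduceAdd, h1, h2, h3, h4]
  simp only [evalEval, pow_zero, pow_one, eval_pow, eval_X, eval_C, eval_one]
  rw [div_mul_eq_mul_div]
  congr 1
  simp
  ring

/-- `∑_j g_j(P) h_j(Q)`. -/
noncomputable def ghSum (lam : Fin 5 → ℂ) (P Q : ℂ × ℂ) : ℂ := ∑ j, gNum j P * hNum lam j Q

theorem coeffR_eq (lam : Fin 5 → ℂ) {P Q : ℂ × ℂ} (h : Generic P Q) :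
    coeffR lam P Q = ((P.2 ^ 3 + P.2 ^ 2 * Q.2 + P.2 * Q.2 ^ 2 + Q.2 ^ 3) / (P.1 - Q.1) ^ 2 +
        (P.2 ^ 2 + 2 * P.2 * Q.2 + 3 * Q.2 ^ 2) / (P.1 - Q.1) *
          ((quintic lam).derivative.eval Q.1 / (4 * Q.2 ^ 3)) +
        ghSum lam P Q / (4 * Q.2 ^ 3)) / (4 * P.2 ^ 3) := by
  obtain ⟨hx, hy, hw⟩ := h
  have hx' : P.1 - Q.1 ≠ 0 := sub_ne_zero.2 hx
  have h1 : HasFDerivAt (fun Q : ℂ × ℂ => Q.1) (ContinuousLinearMap.fst ℂ ℂ ℂ) Q := hasFDerivAt_fst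
  have h2 : HasFDerivAt (fun Q : ℂ × ℂ => Q.2) (ContinuousLinearMap.snd ℂ ℂ ℂ) Q := hasFDerivAt_snd
  have hd := ((((h2.const_mul (P.2 ^ 2)).const_add (P.2 ^ 3)).add ((h2.pow 2).const_mul P.2)).add
      (h2.pow 3)).mul ((hasDerivAt_inv (x := 4 * P.2 ^ 3 * (P.1 - Q.1))
        (by simp [hx', hy])).comp_hasFDerivAt Q ((h1.const_sub P.1).const_mul (4 * P.2 ^ 3)))
  -- Σ in the exact shape of the product that `hd` differentiates.
  have e : Sig lam P = (((fun Q => P.2 ^ 3 + P.2 ^ 2 * Q.2) + fun Q => P.2 * Q.2 ^ 2) +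
      fun Q => Q.2 ^ 3) * (fun y => y⁻¹) ∘ fun Q => 4 * P.2 ^ 3 * (P.1 - Q.1) :=
    funext fun Q => by simp [Sig_eq, div_eq_mul_inv]
  rw [coeffR, curveDeriv, e, hd.fderiv, curveEqX_eq, curveEqY_eq]
  have hs : ∑ j, duCoeff j P * drCoeff lam j Q = ghSum lam P Q / (4 * Q.2 ^ 3) / (4 * P.2 ^ 3) := by
    simp only [ghSum, Finset.sum_div, duCoeff, drCoeff]
    refine Finset.sum_congr rfl fun j _ => ?_
    field_simp
  rw [hs, add_div _ (ghSum lam P Q / _)]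
  congr 1
  simp
  field_simp

theorem polyF_symm (lam : Fin 5 → ℂ) (P Q : ℂ × ℂ) : polyF lam P Q = polyF lam Q P := by
  simp only [polyF]
  ring

/-- The right-hand side is the numerator of `coeffR_eq` over the common denominator (x -
z)²·4y³·4w³. Only (z,w) has to lie on the curve. -/
theorem polyF_eq (lam : Fin 5 → ℂ) (P : ℂ × ℂ) {Q : ℂ × ℂ} (hQ : curveEq lam Q = 0) :
    polyF lam P Q = 4 * Q.2 ^ 3 * (P.2 ^ 3 + P.2 ^ 2 * Q.2 + P.2 * Q.2 ^ 2 + Q.2 ^ 3) +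
      (P.2 ^ 2 + 2 * P.2 * Q.2 + 3 * Q.2 ^ 2) * (P.1 - Q.1) * (quintic lam).derivative.eval Q.1 +
      (P.1 - Q.1) ^ 2 * ghSum lam P Q := by
  rw [curveEq_eq, quintic_eval] at hQ
  simp only [polyF, quintic_derivative_eval, ghSum, Fin.sum_univ_six, gNum, hNum]
  simp
  -- The two sides differ by replacing w⁴ with q(z) in 4w⁴(y² + yw + w²).
  linear_combination (-4 * (P.2 ^ 2 + P.2 * Q.2 + Q.2 ^ 2)) * hQ

theorem coeffR_eq_polyF (lam : Fin 5 → ℂ) {P Q : ℂ × ℂ} (hQ : curveEq lam Q = 0)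
    (h : Generic P Q) : coeffR lam P Q =
      polyF lam P Q / ((P.1 - Q.1) ^ 2 * curveEqY lam P * curveEqY lam Q) := by
  rw [coeffR_eq lam h, polyF_eq lam P hQ, curveEqY_eq, curveEqY_eq]
  obtain ⟨hx, hy, hw⟩ := h
  have hx' : P.1 - Q.1 ≠ 0 := sub_ne_zero.2 hx
  field_simp

/-! ### Division of analytic functions of two variables -/

namespace FormalMultilinearSeries

/-- The formal quotient by the first coordinate of a power series in two variables that vanishes
where the first coordinate does. -/
noncomputable def divFst (p : FormalMultilinearSeries ℂ (ℂ × ℂ) ℂ) :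
    FormalMultilinearSeries ℂ (ℂ × ℂ) ℂ := fun n =>
  ∑ k : Fin (n + 1), ((p (n + 1)).curryMid k (1, 0)).compContinuousLinearMap
    fun j : Fin n => if j.castSucc < k then ContinuousLinearMap.id ℂ (ℂ × ℂ)
      else (ContinuousLinearMap.inr ℂ ℂ ℂ).comp (ContinuousLinearMap.snd ℂ ℂ ℂ)

theorem norm_divFst_le (p : FormalMultilinearSeries ℂ (ℂ × ℂ) ℂ) (n : ℕ) :
    ‖p.divFst n‖ ≤ (n + 1) * ‖p (n + 1)‖ := by
  have h (k : Fin (n + 1)) : ‖((p (n + 1)).curryMid k (1, 0)).compContinuousLinearMap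
      fun j : Fin n => if j.castSucc < k then ContinuousLinearMap.id ℂ (ℂ × ℂ)
      else (ContinuousLinearMap.inr ℂ ℂ ℂ).comp (ContinuousLinearMap.snd ℂ ℂ ℂ)‖ ≤ ‖p (n + 1)‖ := by
    refine (ContinuousMultilinearMap.norm_compContinuousLinearMap_le _ _).trans ?_
    have h1 : ‖(p (n + 1)).curryMid k (1, 0)‖ ≤ ‖p (n + 1)‖ := by
      refine (ContinuousLinearMap.le_opNorm _ _).trans ?_
      rw [ContinuousMultilinearMap.norm_curryMid]
      simp [Prod.norm_def]
    refine (mul_le_of_le_one_right (norm_nonneg _) (Finset.prod_le_one (fun _ _ => norm_nonneg _)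
      fun j _ => ?_)).trans h1
    split_ifs
    · exact ContinuousLinearMap.norm_id_le
    · refine ContinuousLinearMap.opNorm_le_bound _ zero_le_one fun x => ?_
      simp [Prod.norm_def]
  refine (norm_sum_le_of_le _ fun k _ => h k).trans (by simp)

/-- Telescoping: the arguments (0, x.2) are replaced by x one slot at a time, and by linearity in
that slot each replacement contributes x.1 times the value at (1, 0). -/
theorem mul_divFst_apply (p : FormalMultilinearSeries ℂ (ℂ × ℂ) ℂ) (n : ℕ) (x : ℂ × ℂ) :
    x.1 * p.divFst n (fun _ => x) = p (n + 1) (fun _ => x) - p (n + 1) (fun _ => (0, x.2)) := by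
  let A (k : ℕ) : ℂ := p (n + 1) fun i => if (i : ℕ) < k then x else (0, x.2)
  have hA : p (n + 1) (fun _ => x) - p (n + 1) (fun _ => (0, x.2)) = A (n + 1) - A 0 := by
    simp only [A, Fin.is_lt, Nat.not_lt_zero, if_true, if_false]
  rw [hA, ← Finset.sum_range_sub, ← Fin.sum_univ_eq_sum_range (fun k => A (k + 1) - A k)]
  simp only [divFst, _root_.sum_apply, Finset.mul_sum]
  refine Finset.sum_congr rfl fun k _ => ?_
  rw [ContinuousMultilinearMap.compContinuousLinearMap_apply]
  set m : Fin n → ℂ × ℂ := fun j => if j.castSucc < k then x else (0, x.2) with hm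
  have hm' : (fun j : Fin n => (if j.castSucc < k then ContinuousLinearMap.id ℂ (ℂ × ℂ)
      else (ContinuousLinearMap.inr ℂ ℂ ℂ).comp (ContinuousLinearMap.snd ℂ ℂ ℂ)) x) = m := by
    funext j
    simp only [hm]
    split_ifs <;> simp
  have h1 : A (k + 1) = (p (n + 1)).curryMid k x m := by
    rw [ContinuousMultilinearMap.curryMid_apply]
    simp only [A]
    congr 1
    funext i
    refine Fin.succAboveCases k ?_ (fun j => ?_) i
    · simp
    · simp only [Fin.insertNth_apply_succAbove, hm]
      rcases lt_or_ge j.castSucc k with h | h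
      · rw [Fin.succAbove_of_castSucc_lt _ _ h]
        have : (j : ℕ) < k := h
        simp [h, this.le]
      · rw [Fin.succAbove_of_le_castSucc _ _ h]
        have : (k : ℕ) ≤ j := h
        simp [not_lt.2 h, this]
  have h2 : A k = (p (n + 1)).curryMid k (0, x.2) m := by
    rw [ContinuousMultilinearMap.curryMid_apply]
    simp only [A]
    congr 1
    funext i
    refine Fin.succAboveCases k ?_ (fun j => ?_) i
    · simp
    · simp only [Fin.insertNth_apply_succAbove, hm]
      rcases lt_or_ge j.castSucc k with h | h
      · rw [Fin.succAbove_of_castSucc_lt _ _ h]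
        have : (j : ℕ) < k := h
        simp [h, this]
      · rw [Fin.succAbove_of_le_castSucc _ _ h]
        have : (k : ℕ) ≤ j := h
        simp [not_lt.2 h, this.trans (Nat.le_succ _)]
  have h3 : x = x.1 • ((1, 0) : ℂ × ℂ) + (0, x.2) := by ext <;> simp
  rw [hm', h1, h2]
  nth_rewrite 2 [h3]
  rw [map_add, map_smul]
  simp

theorem divFst_radius_pos (p : FormalMultilinearSeries ℂ (ℂ × ℂ) ℂ) (hp : 0 < p.radius) :
    0 < p.divFst.radius := by
  obtain ⟨r, hr0, hr⟩ := ENNReal.lt_iff_exists_nnreal_btwn.1 hp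
  obtain ⟨C, hC, h⟩ := p.norm_mul_pow_le_of_lt_radius hr
  have hr0' : (0 : ℝ) < r := by exact_mod_cast hr0
  -- Halving the radius absorbs the factor n + 1 of `norm_divFst_le`, as n + 1 ≤ 2ⁿ.
  have key : ((r / 2 : NNReal) : ENNReal) ≤ p.divFst.radius := by
    refine p.divFst.le_radius_of_bound (C / r) fun n => ?_
    have h1 : ((n : ℝ) + 1) ≤ 2 ^ n := by exact_mod_cast Nat.succ_le_of_lt n.lt_two_pow_self
    have h2 : ‖p (n + 1)‖ * (r : ℝ) ^ n ≤ C / r := by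
      rw [le_div_iff₀ hr0', mul_assoc, ← pow_succ]
      exact h (n + 1)
    calc ‖p.divFst n‖ * ((r / 2 : NNReal) : ℝ) ^ n
        ≤ ((n + 1) * ‖p (n + 1)‖) * ((r : ℝ) / 2) ^ n := by
          push_cast
          gcongr
          exact p.norm_divFst_le n
      _ = ((n + 1) / 2 ^ n) * (‖p (n + 1)‖ * (r : ℝ) ^ n) := by
          rw [div_pow]; ring
      _ ≤ 1 * (‖p (n + 1)‖ * (r : ℝ) ^ n) := by
          gcongr
          exact div_le_one_of_le₀ h1 (by positivity)
      _ ≤ C / r := by rw [one_mul]; exact h2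
  refine lt_of_lt_of_le ?_ key
  exact_mod_cast half_pos hr0'

end FormalMultilinearSeries

theorem AnalyticAt.exists_eq_fst_mul {G : ℂ × ℂ → ℂ} (hG : AnalyticAt ℂ G 0)
    (h0 : ∀ᶠ v in 𝓝 (0 : ℂ), G (0, v) = 0) :
    ∃ H : ℂ × ℂ → ℂ, AnalyticAt ℂ H 0 ∧ ∀ᶠ u in 𝓝 (0 : ℂ × ℂ), G u = u.1 * H u := by
  obtain ⟨p, hp⟩ := hG
  have hq := p.divFst.hasFPowerSeriesOnBall (p.divFst_radius_pos hp.radius_pos)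
  refine ⟨p.divFst.sum, hq.analyticAt, ?_⟩
  have t : Tendsto (fun x : ℂ × ℂ => ((0, x.2) : ℂ × ℂ)) (𝓝 0) (𝓝 0) :=
    (by fun_prop : Continuous fun x : ℂ × ℂ => ((0, x.2) : ℂ × ℂ)).tendsto' _ _ rfl
  filter_upwards [hp.eventually_hasSum, t.eventually hp.eventually_hasSum,
    hq.hasFPowerSeriesAt.eventually_hasSum, (continuous_snd.tendsto' (0 : ℂ × ℂ) 0 rfl).eventually h0]
    with x h1 h2 h3 h4
  rw [zero_add] at h1 h2 h3
  rw [h4] at h2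
  -- The shift by one drops the constant terms, which agree in the two series and cancel.
  have h5 := (hasSum_nat_add_iff' 1).2 (h1.sub h2)
  have h6 := h3.mul_left x.1
  simp only [p.mul_divFst_apply] at h6
  have e : p 0 (fun _ => x) = p 0 (fun _ => ((0, x.2) : ℂ × ℂ)) := congrArg _ (Subsingleton.elim _ _)
  simpa [e] using h5.unique h6

/-- An analytic function of two variables vanishing on the diagonal is divisible by the difference
of the variables. -/
theorem AnalyticAt.exists_eq_sub_mul {G : ℂ × ℂ → ℂ} (hG : AnalyticAt ℂ G 0)
    (h0 : ∀ᶠ v in 𝓝 (0 : ℂ), G (v, v) = 0) :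
    ∃ H : ℂ × ℂ → ℂ, AnalyticAt ℂ H 0 ∧ ∀ᶠ u in 𝓝 (0 : ℂ × ℂ), G u = (u.1 - u.2) * H u := by
  -- A shear carries the line where the first coordinate vanishes to the diagonal.
  have a1 : AnalyticAt ℂ (fun u : ℂ × ℂ => (u.1 + u.2, u.2)) 0 :=
    (analyticAt_fst.add analyticAt_snd).prod analyticAt_snd
  have a2 : AnalyticAt ℂ (fun u : ℂ × ℂ => (u.1 - u.2, u.2)) 0 :=
    (analyticAt_fst.sub analyticAt_snd).prod analyticAt_snd
  obtain ⟨H, hH, h⟩ := AnalyticAt.exists_eq_fst_mul (hG.comp_of_eq a1 (by simp))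
    (by simpa using h0)
  refine ⟨_, hH.comp_of_eq a2 (by simp), ?_⟩
  have t : Tendsto (fun u : ℂ × ℂ => (u.1 - u.2, u.2)) (𝓝 0) (𝓝 0) :=
    (by fun_prop : Continuous fun u : ℂ × ℂ => (u.1 - u.2, u.2)).tendsto' _ _ (by simp)
  filter_upwards [t.eventually h] with u hu
  simpa using hu

/-! ### Changing the denominator (x - z)² -/

/-- The divided difference of the quintic. -/
noncomputable def quinticDiff (lam : Fin 5 → ℂ) (x z : ℂ) : ℂ :=
  (x ^ 4 + x ^ 3 * z + x ^ 2 * z ^ 2 + x * z ^ 3 + z ^ 4) +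
    lam 4 * (x ^ 3 + x ^ 2 * z + x * z ^ 2 + z ^ 3) + lam 3 * (x ^ 2 + x * z + z ^ 2) +
    lam 2 * (x + z) + lam 1

/-- The second divided difference of the quintic, with one repeated node. -/
noncomputable def quinticDiff₂ (lam : Fin 5 → ℂ) (x z : ℂ) : ℂ :=
  (x ^ 3 + 2 * x ^ 2 * z + 3 * x * z ^ 2 + 4 * z ^ 3) +
    lam 4 * (x ^ 2 + 2 * x * z + 3 * z ^ 2) + lam 3 * (x + 2 * z) + lam 2

theorem quintic_eval_sub (lam : Fin 5 → ℂ) (x z : ℂ) :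
    (quintic lam).eval x - (quintic lam).eval z = (x - z) * quinticDiff lam x z := by
  simp only [quintic_eval, quinticDiff]
  ring

theorem quinticDiff_self (lam : Fin 5 → ℂ) (x : ℂ) :
    quinticDiff lam x x = (quintic lam).derivative.eval x := by
  simp only [quintic_derivative_eval, quinticDiff]
  ring

/-- The numerator of `Ω` relative to the denominator `(y - w)²`. -/
noncomputable def numY (lam : Fin 5 → ℂ) (P Q : ℂ × ℂ) : ℂ :=
  4 * Q.2 ^ 3 * quinticDiff₂ lam P.1 Q.1 * (P.2 - Q.2) +
    quinticDiff lam P.1 Q.1 * (quintic lam).derivative.eval Q.1 +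
    ghSum lam P Q * (P.2 - Q.2) ^ 2

theorem pow_four_sub (lam : Fin 5 → ℂ) {P Q : ℂ × ℂ} (hP : curveEq lam P = 0)
    (hQ : curveEq lam Q = 0) :
    P.2 ^ 4 - Q.2 ^ 4 = (P.1 - Q.1) * quinticDiff lam P.1 Q.1 := by
  rw [curveEq_eq] at hP hQ
  linear_combination hP - hQ + quintic_eval_sub lam P.1 Q.1

/-- Let D be the divided difference of q. In `polyF_eq`, (y - w)(y³ + y²w + yw² + w³) = y⁴ - w⁴ = (x
- z)D and (y - w)²(y² + 2yw + 3w²) = y⁴ - w⁴ - 4w³(y - w). The terms of first order in x - z then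
combine into D - q'(z), which supplies the second factor x - z. -/
theorem polyF_mul_sq (lam : Fin 5 → ℂ) {P Q : ℂ × ℂ} (hP : curveEq lam P = 0)
    (hQ : curveEq lam Q = 0) :
    polyF lam P Q * (P.2 - Q.2) ^ 2 = (P.1 - Q.1) ^ 2 * numY lam P Q := by
  have h := pow_four_sub lam hP hQ
  have h2 : quinticDiff lam P.1 Q.1 - (quintic lam).derivative.eval Q.1 =
      (P.1 - Q.1) * quinticDiff₂ lam P.1 Q.1 := by
    simp only [quintic_derivative_eval, quinticDiff, quinticDiff₂]
    ring
  rw [polyF_eq lam P hQ, numY]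
  linear_combination (4 * Q.2 ^ 3 * (P.2 - Q.2) +
    (P.1 - Q.1) * (quintic lam).derivative.eval Q.1) * h +
    4 * Q.2 ^ 3 * (P.2 - Q.2) * (P.1 - Q.1) * h2

/-- The reversed quintic `1 + λ₄v + ⋯ + λ₀v⁵`. -/
noncomputable def revQuintic (lam : Fin 5 → ℂ) (v : ℂ) : ℂ :=
  1 + lam 4 * v + lam 3 * v ^ 2 + lam 2 * v ^ 3 + lam 1 * v ^ 4 + lam 0 * v ^ 5

/-- The derivative of the reversed quintic. -/
noncomputable def revQuinticDeriv (lam : Fin 5 → ℂ) (v : ℂ) : ℂ :=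
  lam 4 + 2 * lam 3 * v + 3 * lam 2 * v ^ 2 + 4 * lam 1 * v ^ 3 + 5 * lam 0 * v ^ 4

/-- The second divided difference of the reversed quintic, with one repeated node. -/
noncomputable def revQuinticDiff₂ (lam : Fin 5 → ℂ) (v u : ℂ) : ℂ :=
  lam 3 + lam 2 * (v + 2 * u) + lam 1 * (v ^ 2 + 2 * v * u + 3 * u ^ 2) +
    lam 0 * (v ^ 3 + 2 * v ^ 2 * u + 3 * v * u ^ 2 + 4 * u ^ 3)

theorem revQuintic_eq (lam : Fin 5 → ℂ) (v u : ℂ) :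
    revQuintic lam v = revQuintic lam u + (v - u) * revQuinticDeriv lam u +
      (v - u) ^ 2 * revQuinticDiff₂ lam v u := by
  simp only [revQuintic, revQuinticDeriv, revQuinticDiff₂]
  ring

/-- The numerator of `Ω` near infinity relative to the denominator `(T - U)²`, where `T = x / y` and
`v = 1 / x`. -/
noncomputable def numInfinity (lam : Fin 5 → ℂ) (v T u U : ℂ) : ℂ :=
  -4 * U ^ 3 * revQuintic lam u * (T - U) * T ^ 4 * revQuinticDiff₂ lam v u +
    (1 - U ^ 4 * revQuinticDeriv lam u) *
      (1 - T ^ 4 * (revQuinticDeriv lam u + (v - u) * revQuinticDiff₂ lam v u)) +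
    (T - U) ^ 2 * (4 * T ^ 3 * U ^ 3 * revQuintic lam u * revQuinticDiff₂ lam v u +
      U ^ 2 * (lam 3 * u + 2 * lam 2 * u ^ 2 + 3 * lam 1 * u ^ 3 + 4 * lam 0 * u ^ 4) +
      T * U * (2 * lam 3 * u + 4 * lam 2 * u ^ 2 + 2 * lam 1 * u ^ 2 * (v + 3 * u) +
        4 * lam 0 * u ^ 3 * (v + 2 * u)) +
      T ^ 2 * (3 * lam 3 * u + 2 * lam 2 * u * (v + 3 * u) +
        lam 1 * u * (v ^ 2 + 5 * v * u + 9 * u ^ 2) +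
        4 * lam 0 * u ^ 2 * (v ^ 2 + 2 * v * u + 3 * u ^ 2)))

/-- The analogue of `polyF_mul_sq` at infinity. The factor T²U²v⁴u⁴ collects T²v² and U²u² from the
two differentials dx/(4y³), and v²u² from (1/v - 1/u)². -/
theorem polyF_infinity (lam : Fin 5 → ℂ) {v T u U : ℂ} (hT : T ≠ 0) (hU : U ≠ 0) (hv0 : v ≠ 0)
    (hu0 : u ≠ 0) (hv : v = T ^ 4 * revQuintic lam v) (hu : u = U ^ 4 * revQuintic lam u) :
    polyF lam (1 / v, 1 / (v * T)) (1 / u, 1 / (u * U)) * (T ^ 2 * U ^ 2 * v ^ 4 * u ^ 4) *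
      (T - U) ^ 2 = (v - u) ^ 2 * numInfinity lam v T u U := by
  have h1 : v / T = T ^ 3 * revQuintic lam v := by
    rw [div_eq_iff hT]
    linear_combination hv
  have h2 : u / U = U ^ 3 * revQuintic lam u := by
    rw [div_eq_iff hU]
    linear_combination hu
  have h3 : polyF lam (1 / v, 1 / (v * T)) (1 / u, 1 / (u * U)) * (T ^ 2 * U ^ 2 * v ^ 4 * u ^ 4) =
      4 * (v / T) * (u / U) +
      U ^ 2 * (4 * u * revQuintic lam u + (3 * revQuintic lam u + u * revQuinticDeriv lam u) *
        (v - u) + (lam 3 * u + 2 * lam 2 * u ^ 2 + 3 * lam 1 * u ^ 3 + 4 * lam 0 * u ^ 4) *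
        (v - u) ^ 2) +
      T * U * (4 * u * revQuintic lam u + (2 * revQuintic lam u + 2 * u * revQuinticDeriv lam u) *
        (v - u) + (2 * lam 3 * u + 4 * lam 2 * u ^ 2 + 2 * lam 1 * u ^ 2 * (v + 3 * u) +
        4 * lam 0 * u ^ 3 * (v + 2 * u)) * (v - u) ^ 2) +
      T ^ 2 * (4 * u * revQuintic lam u + (revQuintic lam u + 3 * u * revQuinticDeriv lam u) *
        (v - u) + (3 * lam 3 * u + 2 * lam 2 * u * (v + 3 * u) +
        lam 1 * u * (v ^ 2 + 5 * v * u + 9 * u ^ 2) +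
        4 * lam 0 * u ^ 2 * (v ^ 2 + 2 * v * u + 3 * u ^ 2)) * (v - u) ^ 2) := by
    simp only [polyF, revQuintic, revQuinticDeriv]
    field_simp
    ring
  have hQ := revQuintic_eq lam v u
  rw [h3, h1, h2, numInfinity]
  -- Beyond the curve relations, only the expansion `hQ` of the reversed quintic at u matters now;
  -- the brackets e₁, e₂, e₃ occur identically on both sides.
  generalize revQuintic lam v = q at *
  generalize revQuintic lam u = r at *
  generalize revQuinticDeriv lam u = r' at *
  generalize revQuinticDiff₂ lam v u = d at *
  generalize lam 3 * u + 2 * lam 2 * u ^ 2 + 3 * lam 1 * u ^ 3 + 4 * lam 0 * u ^ 4 = e₁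
  generalize 2 * lam 3 * u + 4 * lam 2 * u ^ 2 + 2 * lam 1 * u ^ 2 * (v + 3 * u) +
        4 * lam 0 * u ^ 3 * (v + 2 * u) = e₂
  generalize 3 * lam 3 * u + 2 * lam 2 * u * (v + 3 * u) +
        lam 1 * u * (v ^ 2 + 5 * v * u + 9 * u ^ 2) +
        4 * lam 0 * u ^ 2 * (v ^ 2 + 2 * v * u + 3 * u ^ 2) = e₃
  clear h1 h2 h3 hT hU hv0 hu0
  subst hQ
  obtain ⟨δ, rfl⟩ : ∃ δ, v = u + δ := ⟨v - u, by ring⟩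
  linear_combination (T - U) ^ 2 * (4 * r * (U ^ 2 + T * U + T ^ 2) +
    δ * r' * (U ^ 2 + 2 * T * U + 3 * T ^ 2)) * hu -
    (4 * U ^ 3 * r * (T - U) + δ * (1 - U ^ 4 * r')) * (hv - hu)

/-! ### The double pole on the diagonal -/

/-- The divided difference of an analytic function is analytic in both variables. -/
theorem AnalyticAt.exists_divided_difference {g : ℂ → ℂ} (hg : AnalyticAt ℂ g 0) :
    ∃ X : ℂ × ℂ → ℂ, AnalyticAt ℂ X 0 ∧ X 0 = deriv g 0 ∧
      ∀ᶠ u in 𝓝 (0 : ℂ × ℂ), g u.1 - g u.2 = (u.1 - u.2) * X u := by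
  have h1 : AnalyticAt ℂ (fun u : ℂ × ℂ => g u.1) 0 := hg.comp_of_eq analyticAt_fst rfl
  have h2 : AnalyticAt ℂ (fun u : ℂ × ℂ => g u.2) 0 := hg.comp_of_eq analyticAt_snd rfl
  obtain ⟨X, hX, h⟩ := (h1.sub h2).exists_eq_sub_mul (by simp)
  refine ⟨X, hX, ?_, h⟩
  have t : Tendsto (fun s : ℂ => ((s, 0) : ℂ × ℂ)) (𝓝 0) (𝓝 0) :=
    (by fun_prop : Continuous fun s : ℂ => ((s, 0) : ℂ × ℂ)).tendsto' _ _ rfl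
  have l1 : Tendsto (fun s : ℂ => X (s, 0)) (𝓝[≠] 0) (𝓝 (X 0)) :=
    (hX.continuousAt.tendsto.comp t).mono_left nhdsWithin_le_nhds
  have l2 := hasDerivAt_iff_tendsto_slope.1 hg.differentiableAt.hasDerivAt
  refine tendsto_nhds_unique (l1.congr' ?_) l2
  filter_upwards [(t.eventually h).filter_mono nhdsWithin_le_nhds, self_mem_nhdsWithin] with s hs hs0
  simp only [Pi.sub_apply, sub_zero] at hs
  rw [slope_def_field, hs, sub_zero, mul_div_cancel_left₀ _ hs0]

/-- A function analytic on the square of a neighbourhood of `0`, equal to `1` on the diagonal and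
symmetric near the diagonal, is `1` up to second order along the diagonal. -/
theorem AnalyticAt.exists_eq_one_add_sq_mul {N : ℂ × ℂ → ℂ} (hN : AnalyticAt ℂ N 0)
    (h1 : ∀ᶠ t in 𝓝[≠] (0 : ℂ), N (t, t) = 1)
    (hs : ∀ᶠ t in 𝓝[≠] (0 : ℂ), ∀ᶠ s in 𝓝[≠] t, N (s, t) = N (t, s)) :
    ∃ H : ℂ × ℂ → ℂ, AnalyticAt ℂ H 0 ∧
      ∀ᶠ u in 𝓝 (0 : ℂ × ℂ), N u = 1 + (u.1 - u.2) ^ 2 * H u := by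
  have td : Tendsto (fun t : ℂ => ((t, t) : ℂ × ℂ)) (𝓝 0) (𝓝 0) :=
    (by fun_prop : Continuous fun t : ℂ => ((t, t) : ℂ × ℂ)).tendsto' _ _ rfl
  -- Values on the diagonal are known only away from the origin; the identity theorem in t fills in
  -- t = 0.
  have ext_zero {g : ℂ × ℂ → ℂ} (hg : AnalyticAt ℂ g 0) (h : ∀ᶠ t in 𝓝[≠] (0 : ℂ), g (t, t) = 0) :
      ∀ᶠ t in 𝓝 (0 : ℂ), g (t, t) = 0 := by
    have a : AnalyticAt ℂ (fun t : ℂ => g (t, t)) 0 :=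
      hg.comp_of_eq (analyticAt_id.prod analyticAt_id) rfl
    exact a.frequently_zero_iff_eventually_zero.1 h.frequently
  obtain ⟨M, hM, hNM⟩ := (hN.sub analyticAt_const).exists_eq_sub_mul (ext_zero
    (g := fun u => N u - 1) (hN.sub analyticAt_const) (h1.mono fun t ht => by simp [ht]))
  -- Symmetry of N gives (s - t)M(s,t) = (t - s)M(t,s), so M(s,t) = -M(t,s); letting s → t gives
  -- M(t,t) = 0.
  have hM0 : ∀ᶠ t in 𝓝[≠] (0 : ℂ), M (t, t) = 0 := by
    filter_upwards [hs, (td.eventually hNM.eventually_nhds).filter_mono nhdsWithin_le_nhds,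
      (td.eventually hM.eventually_analyticAt).filter_mono nhdsWithin_le_nhds] with t h2 h3 h4
    have t1 : Tendsto (fun s : ℂ => ((s, t) : ℂ × ℂ)) (𝓝[≠] t) (𝓝 (t, t)) :=
      ((by fun_prop : Continuous fun s : ℂ => ((s, t) : ℂ × ℂ)).tendsto _).mono_left
        nhdsWithin_le_nhds
    have t2 : Tendsto (fun s : ℂ => ((t, s) : ℂ × ℂ)) (𝓝[≠] t) (𝓝 (t, t)) :=
      ((by fun_prop : Continuous fun s : ℂ => ((t, s) : ℂ × ℂ)).tendsto _).mono_left
        nhdsWithin_le_nhds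
    have l1 := h4.continuousAt.tendsto.comp t1
    have l2 := (h4.continuousAt.tendsto.comp t2).neg
    have e := tendsto_nhds_unique (l1.congr' (by
      filter_upwards [h2, t1.eventually h3, t2.eventually h3, self_mem_nhdsWithin] with s a b c d
      have d' : s - t ≠ 0 := sub_ne_zero.2 d
      simp only [Pi.sub_apply] at b c
      refine mul_left_cancel₀ d' ?_
      simp only [Function.comp_apply]
      linear_combination a - b + c)) l2
    linear_combination e / 2
  obtain ⟨H, hH, hMH⟩ := hM.exists_eq_sub_mul (ext_zero hM hM0)
  refine ⟨H, hH, ?_⟩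
  filter_upwards [hNM, hMH] with u a b
  rw [b] at a
  simp only [Pi.sub_apply] at a
  linear_combination a

/-- A parametrised arc of the affine curve at whose points `x` is a local coordinate and `y` does
not vanish. -/
def RegularAt (lam : Fin 5 → ℂ) (γ : ℂ → ℂ × ℂ) (t : ℂ) : Prop :=
  AnalyticAt ℂ (fun s => (γ s).1) t ∧ ContinuousAt (fun s => (γ s).2) t ∧
    deriv (fun s => (γ s).1) t ≠ 0 ∧ (γ t).2 ≠ 0 ∧ curveEq lam (γ t) = 0

theorem polyF_self (lam : Fin 5 → ℂ) {P : ℂ × ℂ} (hP : curveEq lam P = 0) :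
    polyF lam P P = 16 * P.2 ^ 6 := by
  rw [polyF_eq lam P hP]
  ring

theorem pullback₂_eq (lam : Fin 5 → ℂ) (γ δ : ℂ → ℂ × ℂ) {s t : ℂ} (ht : curveEq lam (δ t) = 0)
    (h : Generic (γ s) (δ t)) :
    pullback₂ (coeffR lam) γ δ s t = polyF lam (γ s) (δ t) / ((γ s).1 - (δ t).1) ^ 2 *
      (deriv (fun s' => (γ s').1) s / (4 * (γ s).2 ^ 3)) *
      (deriv (fun t' => (δ t').1) t / (4 * (δ t).2 ^ 3)) := by
  rw [pullback₂, coeffR_eq_polyF lam ht h, curveEqY_eq, curveEqY_eq]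
  simp only [div_eq_mul_inv, mul_inv]
  ring

theorem Generic.symm {P Q : ℂ × ℂ} (h : Generic P Q) : Generic Q P := ⟨h.1.symm, h.2.2, h.2.1⟩

theorem pullback₂_symm (lam : Fin 5 → ℂ) (γ δ : ℂ → ℂ × ℂ) {s t : ℂ} (hs : curveEq lam (γ s) = 0)
    (ht : curveEq lam (δ t) = 0) (h : Generic (γ s) (δ t)) :
    pullback₂ (coeffR lam) γ δ s t = pullback₂ (coeffR lam) δ γ t s := by
  rw [pullback₂_eq lam γ δ ht h, pullback₂_eq lam δ γ hs h.symm, polyF_symm,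
    ← neg_sub (γ s).1, neg_sq]
  ring

theorem RegularAt.eventually_generic {lam : Fin 5 → ℂ} {γ : ℂ → ℂ × ℂ} {t : ℂ}
    (h : RegularAt lam γ t) : ∀ᶠ s in 𝓝[≠] t, Generic (γ s) (γ t) := by
  obtain ⟨hx, hy, hd, hy0, -⟩ := h
  filter_upwards [hx.differentiableAt.hasDerivAt.eventually_ne (c := (γ t).1) hd,
    (hy.eventually_ne hy0).filter_mono nhdsWithin_le_nhds] with s h1 h2 using ⟨h1, h2, hy0⟩

/-- The difference quotient of x tends to x'(t), and F(P,P) = 16y⁶ = (4y³)² cancels the two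
denominators. -/
theorem RegularAt.tendsto_sub_sq_mul_pullback₂ {lam : Fin 5 → ℂ} {γ : ℂ → ℂ × ℂ} {t : ℂ}
    (h : RegularAt lam γ t) :
    Tendsto (fun s => (s - t) ^ 2 * pullback₂ (coeffR lam) γ γ s t) (𝓝[≠] t) (𝓝 1) := by
  have hg := h.eventually_generic
  obtain ⟨hx, hy, hd, hy0, hc⟩ := h
  set x' := deriv (fun s => (γ s).1) with hx'
  have hsl := hasDerivAt_iff_tendsto_slope.1 hx.differentiableAt.hasDerivAt
  have hγ : ContinuousAt γ t := hx.continuousAt.prodMk hy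
  have hF : Tendsto (fun s => polyF lam (γ s) (γ t)) (𝓝[≠] t) (𝓝 (polyF lam (γ t) (γ t))) := by
    have : Continuous fun P : ℂ × ℂ => polyF lam P (γ t) := by
      simp only [polyF]
      fun_prop
    exact (this.continuousAt.tendsto.comp hγ.tendsto).mono_left nhdsWithin_le_nhds
  have hω : Tendsto (fun s => x' s / (4 * (γ s).2 ^ 3)) (𝓝[≠] t)
      (𝓝 (x' t / (4 * (γ t).2 ^ 3))) := by
    refine Tendsto.mono_left ?_ nhdsWithin_le_nhds
    exact hx.deriv.continuousAt.tendsto.div ((hy.tendsto.pow 3).const_mul 4) (by simp [hy0])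
  have l := ((hF.div (hsl.pow 2) (pow_ne_zero 2 hd)).mul hω).mul_const (x' t / (4 * (γ t).2 ^ 3))
  have e : polyF lam (γ t) (γ t) / deriv (fun s => (γ s).1) t ^ 2 * (x' t / (4 * (γ t).2 ^ 3)) *
      (x' t / (4 * (γ t).2 ^ 3)) = 1 := by
    rw [polyF_self lam hc, ← hx']
    field_simp
    ring
  rw [e] at l
  refine l.congr' ?_
  filter_upwards [hg, self_mem_nhdsWithin] with s hs hst
  have hst' : s - t ≠ 0 := sub_ne_zero.2 hst
  rw [pullback₂_eq lam γ γ hc hs, ← hx', Pi.div_apply, slope_def_field, div_pow]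
  have := sub_ne_zero.2 hs.1
  field_simp

/-- An analytic extension of (s - t)²Ω suffices: its diagonal values and its symmetry can be read
off at nearby regular points, even if the centre itself is a branch point or infinity. -/
theorem exists_diagonal_remainder {lam : Fin 5 → ℂ} {γ : ℂ → ℂ × ℂ}
    (hreg : ∀ᶠ t in 𝓝[≠] (0 : ℂ), RegularAt lam γ t) {N : ℂ × ℂ → ℂ} (hN : AnalyticAt ℂ N 0)
    (h : ∀ᶠ u in 𝓝 (0 : ℂ × ℂ), u.1 ≠ 0 → u.2 ≠ 0 → Generic (γ u.1) (γ u.2) →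
      (u.1 - u.2) ^ 2 * pullback₂ (coeffR lam) γ γ u.1 u.2 = N u) :
    ∃ H : ℂ × ℂ → ℂ, AnalyticAt ℂ H (0, 0) ∧ ∀ᶠ u : ℂ × ℂ in 𝓝 (0, 0),
      u.1 ≠ 0 → u.2 ≠ 0 → Generic (γ u.1) (γ u.2) →
        pullback₂ (coeffR lam) γ γ u.1 u.2 = 1 / (u.1 - u.2) ^ 2 + H u := by
  have td : Tendsto (fun t : ℂ => ((t, t) : ℂ × ℂ)) (𝓝[≠] 0) (𝓝 0) :=
    ((by fun_prop : Continuous fun t : ℂ => ((t, t) : ℂ × ℂ)).tendsto' _ _ rfl).mono_left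
      nhdsWithin_le_nhds
  have t1 (t : ℂ) : Tendsto (fun s : ℂ => ((s, t) : ℂ × ℂ)) (𝓝[≠] t) (𝓝 (t, t)) :=
    ((by fun_prop : Continuous fun s : ℂ => ((s, t) : ℂ × ℂ)).tendsto _).mono_left
      nhdsWithin_le_nhds
  have t2 (t : ℂ) : Tendsto (fun s : ℂ => ((t, s) : ℂ × ℂ)) (𝓝[≠] t) (𝓝 (t, t)) :=
    ((by fun_prop : Continuous fun s : ℂ => ((t, s) : ℂ × ℂ)).tendsto _).mono_left
      nhdsWithin_le_nhds
  have ne0 {t : ℂ} (ht : t ≠ 0) : ∀ᶠ s in 𝓝[≠] t, s ≠ 0 :=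
    (eventually_ne_nhds ht).filter_mono nhdsWithin_le_nhds
  obtain ⟨H, hH, hNH⟩ := hN.exists_eq_one_add_sq_mul (by
    filter_upwards [hreg, td.eventually h.eventually_nhds, td.eventually hN.eventually_analyticAt,
      self_mem_nhdsWithin] with t a b c d
    refine tendsto_nhds_unique ((c.continuousAt.tendsto.comp (t1 t)).congr' ?_)
      a.tendsto_sub_sq_mul_pullback₂
    filter_upwards [(t1 t).eventually b, ne0 d, a.eventually_generic] with s e f g
    exact (e f d g).symm) (by
    filter_upwards [hreg, td.eventually h.eventually_nhds, self_mem_nhdsWithin,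
      eventually_nhdsNE_eventually_nhds_iff.2 hreg] with t a b d r
    have r' := r.filter_mono (nhdsWithin_le_nhds (s := {t}ᶜ))
    filter_upwards [(t1 t).eventually b, (t2 t).eventually b, ne0 d, a.eventually_generic, r']
      with s e e' f g r'
    rw [← e f d g, ← e' d f g.symm, pullback₂_symm lam γ γ r'.2.2.2.2 a.2.2.2.2 g]
    ring)
  refine ⟨H, hH, ?_⟩
  filter_upwards [h, hNH] with u a b h1 h2 h3
  have h4 : u.1 - u.2 ≠ 0 := by
    intro e
    exact h3.1 (by rw [sub_eq_zero.1 e])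
  have := a h1 h2 h3
  rw [b] at this
  field_simp
  linear_combination this

/-! ### Local parameters on the affine curve -/

/-- The relation 4y³ dy = q'(x) dx, by differentiating the curve equation. -/
theorem curveEq_deriv {lam : Fin 5 → ℂ} {γ : ℂ → ℂ × ℂ} {t : ℂ}
    (hx : DifferentiableAt ℂ (fun s => (γ s).1) t) (hy : DifferentiableAt ℂ (fun s => (γ s).2) t)
    (h : ∀ᶠ s in 𝓝 t, curveEq lam (γ s) = 0) :
    4 * (γ t).2 ^ 3 * deriv (fun s => (γ s).2) t =
      (quintic lam).derivative.eval (γ t).1 * deriv (fun s => (γ s).1) t := by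
  have h1 := (hy.hasDerivAt.pow 4).sub
    (((quintic lam).hasDerivAt (γ t).1).comp t hx.hasDerivAt)
  have h2 : HasDerivAt (fun s => curveEq lam (γ s)) 0 t :=
    (hasDerivAt_const t (0 : ℂ)).congr_of_eventuallyEq h
  have h3 : (fun s => curveEq lam (γ s)) = (fun s => (γ s).2) ^ 4 -
      (fun x => (quintic lam).eval x) ∘ fun s => (γ s).1 := by
    funext s
    simp [curveEq_eq]
  rw [h3] at h2
  have := h1.unique h2
  simp only [Nat.cast_ofNat, Nat.add_one_sub_one] at this
  linear_combination this

theorem quintic_derivative_eval_ne_zero {lam : Fin 5 → ℂ} (hns : IsNonsingular lam) {P : ℂ × ℂ}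
    (hP : curveEq lam P = 0) (h : P.2 = 0) : (quintic lam).derivative.eval P.1 ≠ 0 := by
  have := hns P hP
  simpa [curveEqX_eq, curveEqY_eq, h] using this

/-- At y = 0 the relation 4y³ dy = q'(x) dx with q'(x) ≠ 0 forces dx = 0, so an immersed arc must
have dy ≠ 0. -/
theorem IsLocalParam.deriv_snd_ne_zero {lam : Fin 5 → ℂ} {P : ℂ × ℂ} {hP : curveEq lam P = 0}
    {γ : ℂ → ℂ × ℂ} (hns : IsNonsingular lam) (h : IsLocalParam lam (.affine P hP) γ)
    (hy : P.2 = 0) : deriv (fun s => (γ s).2) 0 ≠ 0 := by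
  obtain ⟨ha, h0, hd, hc⟩ := h
  have hx := (analyticAt_fst.comp ha).differentiableAt
  have hy' := (analyticAt_snd.comp ha).differentiableAt
  have e := curveEq_deriv hx hy' hc
  intro h2
  rw [h0, h2, mul_zero, eq_comm, mul_eq_zero] at e
  have h1 := e.resolve_left (quintic_derivative_eval_ne_zero hns hP hy)
  apply hd
  have := hx.hasDerivAt.prodMk hy'.hasDerivAt
  have e2 := this.deriv
  exact e2.trans (Prod.ext h1 h2)

theorem IsLocalParam.deriv_fst_ne_zero {lam : Fin 5 → ℂ} {P : ℂ × ℂ} {hP : curveEq lam P = 0}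
    {γ : ℂ → ℂ × ℂ} (h : IsLocalParam lam (.affine P hP) γ)
    (hy : P.2 ≠ 0) : deriv (fun s => (γ s).1) 0 ≠ 0 := by
  obtain ⟨ha, h0, hd, hc⟩ := h
  have hx := (analyticAt_fst.comp ha).differentiableAt
  have hy' := (analyticAt_snd.comp ha).differentiableAt
  have e := curveEq_deriv hx hy' hc
  intro h1
  have h1' := h1
  rw [h0, h1, mul_zero, mul_eq_zero] at e
  have h2 := e.resolve_left (by simp [hy])
  apply hd
  have := hx.hasDerivAt.prodMk hy'.hasDerivAt
  have e2 := this.deriv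
  exact e2.trans (Prod.ext h1' h2)

/-- On the affine curve, `dx / (4y³)` is holomorphic. -/
theorem IsLocalParam.exists_affine_form {lam : Fin 5 → ℂ} {P : ℂ × ℂ} {hP : curveEq lam P = 0}
    {γ : ℂ → ℂ × ℂ} (hns : IsNonsingular lam) (h : IsLocalParam lam (.affine P hP) γ) :
    (∀ᶠ t in 𝓝[≠] (0 : ℂ), RegularAt lam γ t) ∧
    ∃ ω : ℂ → ℂ, AnalyticAt ℂ ω 0 ∧
      (∀ᶠ t in 𝓝 (0 : ℂ), (γ t).2 ≠ 0 → deriv (fun s => (γ s).1) t / (4 * (γ t).2 ^ 3) = ω t) := by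
  have h' := h
  obtain ⟨ha, h0, hd, hc⟩ := h'
  have hx : AnalyticAt ℂ (fun s => (γ s).1) 0 := analyticAt_fst.comp ha
  have hy : AnalyticAt ℂ (fun s => (γ s).2) 0 := analyticAt_snd.comp ha
  have he : ∀ᶠ t in 𝓝 (0 : ℂ), 4 * (γ t).2 ^ 3 * deriv (fun s => (γ s).2) t =
      (quintic lam).derivative.eval (γ t).1 * deriv (fun s => (γ s).1) t := by
    filter_upwards [hx.eventually_analyticAt, hy.eventually_analyticAt, hc.eventually_nhds]
      with t a b c using curveEq_deriv a.differentiableAt b.differentiableAt c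
  by_cases hP2 : P.2 = 0
  · have hy' := h.deriv_snd_ne_zero hns hP2
    have hq := quintic_derivative_eval_ne_zero hns hP hP2
    have hqa : AnalyticAt ℂ (fun t => (quintic lam).derivative.eval (γ t).1) 0 := by
      simp only [quintic_derivative_eval]
      fun_prop
    have hq' : ∀ᶠ t in 𝓝 (0 : ℂ), (quintic lam).derivative.eval (γ t).1 ≠ 0 :=
      hqa.continuousAt.eventually_ne (by rwa [h0])
    have hy0 : ∀ᶠ t in 𝓝[≠] (0 : ℂ), (γ t).2 ≠ 0 :=
      hy.differentiableAt.hasDerivAt.eventually_ne hy'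
    have hy'' : ∀ᶠ t in 𝓝 (0 : ℂ), deriv (fun s => (γ s).2) t ≠ 0 :=
      hy.deriv.continuousAt.eventually_ne hy'
    -- Near a branch point dx/(4y³) = dy/q'(x).
    refine ⟨?_, fun t => deriv (fun s => (γ s).2) t / (quintic lam).derivative.eval (γ t).1,
      hy.deriv.div hqa (by rwa [h0]), ?_⟩
    · filter_upwards [hy0, hx.eventually_analyticAt.filter_mono nhdsWithin_le_nhds,
        hy.eventually_analyticAt.filter_mono nhdsWithin_le_nhds,
        hc.filter_mono nhdsWithin_le_nhds, he.filter_mono nhdsWithin_le_nhds,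
        hy''.filter_mono nhdsWithin_le_nhds] with t a b c d e f
      refine ⟨b, c.continuousAt, fun h1 => ?_, a, d⟩
      rw [h1, mul_zero] at e
      simp [a, f] at e
    · filter_upwards [hq', he] with t a b c
      field_simp
      linear_combination -b
  · have hx' := h.deriv_fst_ne_zero hP2
    have hy0 : ∀ᶠ t in 𝓝 (0 : ℂ), (γ t).2 ≠ 0 := hy.continuousAt.eventually_ne (by rwa [h0])
    refine ⟨?_, fun t => deriv (fun s => (γ s).1) t / (4 * (γ t).2 ^ 3),
      hx.deriv.div (by fun_prop) (by simpa [h0] using hP2), by simp⟩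
    filter_upwards [hy0.filter_mono nhdsWithin_le_nhds,
        hx.eventually_analyticAt.filter_mono nhdsWithin_le_nhds,
        hy.eventually_analyticAt.filter_mono nhdsWithin_le_nhds,
        hc.filter_mono nhdsWithin_le_nhds,
        (hx.deriv.continuousAt.eventually_ne hx').filter_mono nhdsWithin_le_nhds] with t a b c d e
      using ⟨b, c.continuousAt, e, a, d⟩

/-! ### Local parameters at infinity -/

theorem quintic_eval_one_div (lam : Fin 5 → ℂ) {v : ℂ} (hv : v ≠ 0) :
    (quintic lam).eval (1 / v) = revQuintic lam v / v ^ 5 := by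
  rw [quintic_eval, revQuintic]
  field_simp

theorem revQuintic_zero (lam : Fin 5 → ℂ) : revQuintic lam 0 = 1 := by simp [revQuintic]

theorem AnalyticAt.revQuintic {lam : Fin 5 → ℂ} {E : Type*} [NormedAddCommGroup E]
    [NormedSpace ℂ E] {v : E → ℂ} {t : E} (hv : AnalyticAt ℂ v t) :
    AnalyticAt ℂ (fun s => revQuintic lam (v s)) t := by
  simp only [_root_.revQuintic]
  fun_prop

theorem AnalyticAt.revQuinticDeriv {lam : Fin 5 → ℂ} {E : Type*} [NormedAddCommGroup E]
    [NormedSpace ℂ E] {v : E → ℂ} {t : E} (hv : AnalyticAt ℂ v t) :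
    AnalyticAt ℂ (fun s => revQuinticDeriv lam (v s)) t := by
  simp only [_root_.revQuinticDeriv]
  fun_prop

theorem hasDerivAt_revQuintic (lam : Fin 5 → ℂ) (v : ℂ) :
    HasDerivAt (revQuintic lam) (revQuinticDeriv lam v) v := by
  have h (n : ℕ) := hasDerivAt_pow n v
  have := (((((((hasDerivAt_id v).const_mul (lam 4)).const_add 1).add ((h 2).const_mul (lam 3))).add
    ((h 3).const_mul (lam 2))).add ((h 4).const_mul (lam 1))).add ((h 5).const_mul (lam 0)))
  refine (this.congr_deriv ?_).congr_of_eventuallyEq (Eventually.of_forall fun s => ?_)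
  · simp [revQuinticDeriv]
    ring
  · simp [revQuintic]

/-- Near infinity, `x = t⁻⁴ a(t)` and `y = t⁻⁵ b(t)` with `a` and `b` holomorphic units. -/
theorem IsLocalParam.exists_leading_factors {lam : Fin 5 → ℂ} {γ : ℂ → ℂ × ℂ}
    (h : IsLocalParam lam .infinity γ) : ∃ a b : ℂ → ℂ, AnalyticAt ℂ a 0 ∧ AnalyticAt ℂ b 0 ∧
      a 0 ≠ 0 ∧ b 0 ≠ 0 ∧
      ∀ᶠ t in 𝓝[≠] (0 : ℂ), (γ t).1 = a t / t ^ 4 ∧ (γ t).2 = b t / t ^ 5 := by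
  obtain ⟨hx, hy, ho, hc⟩ := h
  obtain ⟨a, ha, ha0, hxa⟩ := (meromorphicOrderAt_eq_int_iff hx (n := -4)).1 ho
  have hva : AnalyticAt ℂ (fun t : ℂ => t ^ 4 / a t) 0 := by fun_prop (disch := assumption)
  -- With v = t⁴/a, y⁴ = q(1/v) is the reversed quintic at v divided by v⁵, that is, t⁻²⁰ times a
  -- unit; hence y has order -5.
  have hoy4 : meromorphicOrderAt ((fun t => (γ t).2) ^ 4) 0 = ((-20 : ℤ) : WithTop ℤ) := by
    refine (meromorphicOrderAt_eq_int_iff (hy.pow 4)).2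
      ⟨fun t => a t ^ 5 * revQuintic lam (t ^ 4 / a t), (ha.pow 5).mul hva.revQuintic,
        by simp [revQuintic_zero, ha0], ?_⟩
    filter_upwards [hxa, hc, self_mem_nhdsWithin,
      (ha.continuousAt.eventually_ne ha0).filter_mono nhdsWithin_le_nhds] with t e f g i
    have g' : t ≠ 0 := g
    have e' : (γ t).1 = 1 / (t ^ 4 / a t) := by
      rw [e, sub_zero, smul_eq_mul, zpow_neg]
      norm_cast
      field_simp
    rw [curveEq_eq, e', quintic_eval_one_div lam (by positivity)] at f
    rw [Pi.pow_apply, sub_eq_zero.1 f, sub_zero, smul_eq_mul, zpow_neg]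
    norm_cast
    field_simp
  have hoy : meromorphicOrderAt (fun t => (γ t).2) 0 = ((-5 : ℤ) : WithTop ℤ) := by
    rw [meromorphicOrderAt_pow hy] at hoy4
    generalize meromorphicOrderAt (fun t => (γ t).2) 0 = n at *
    induction n using WithTop.recTopCoe with
    | top => exact absurd hoy4 (by decide)
    | coe n =>
      have h4 : ((4 * n : ℤ) : WithTop ℤ) = ((-20 : ℤ) : WithTop ℤ) := by
        rw [← hoy4]
        norm_cast
      have h5 := WithTop.coe_injective h4
      norm_cast
      omega
  obtain ⟨b, hb, hb0, hyb⟩ := (meromorphicOrderAt_eq_int_iff hy).1 hoy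
  refine ⟨a, b, ha, hb, ha0, hb0, ?_⟩
  filter_upwards [hxa, hyb] with t e f
  rw [e, f]
  simp only [sub_zero, smul_eq_mul, zpow_neg]
  norm_cast
  constructor <;> ring

/-- Near infinity, `T = x / y` is a local coordinate, `v = 1 / x` is a holomorphic function with
`v = T⁴(1 + λ₄v + ⋯ + λ₀v⁵)`, and `dx / (4y³)` is `T²v²` times a holomorphic differential. -/
theorem IsLocalParam.exists_infinity_coordinates {lam : Fin 5 → ℂ} {γ : ℂ → ℂ × ℂ}
    (h : IsLocalParam lam .infinity γ) : ∃ v T ω : ℂ → ℂ,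
      AnalyticAt ℂ v 0 ∧ AnalyticAt ℂ T 0 ∧ AnalyticAt ℂ ω 0 ∧ v 0 = 0 ∧ T 0 = 0 ∧
      deriv T 0 ≠ 0 ∧ ω 0 ≠ 0 ∧ (∀ᶠ t in 𝓝[≠] (0 : ℂ), v t = T t ^ 4 * revQuintic lam (v t) ∧
        T t ≠ 0 ∧ v t ≠ 0 ∧ γ t = (1 / v t, 1 / (v t * T t)) ∧
        deriv (fun s => (γ s).1) t / (4 * (γ t).2 ^ 3) = ω t * (T t ^ 2 * v t ^ 2) ∧
        RegularAt lam γ t) := by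
  obtain ⟨a, b, ha, hb, ha0, hb0, hab⟩ := h.exists_leading_factors
  obtain ⟨hx, hy, -, hc⟩ := h
  set v : ℂ → ℂ := fun t => t ^ 4 / a t with hv
  set T : ℂ → ℂ := fun t => t * (a t / b t) with hT
  have hva : AnalyticAt ℂ v 0 := by fun_prop (disch := assumption)
  have hTa : AnalyticAt ℂ T 0 := by fun_prop (disch := assumption)
  have hv0 : v 0 = 0 := by simp [hv]
  have hT0 : T 0 = 0 := by simp [hT]
  have hT' : deriv T 0 ≠ 0 := by
    have : DifferentiableAt ℂ (fun t => a t / b t) 0 := (ha.div hb hb0).differentiableAt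
    have e := ((hasDerivAt_id (0 : ℂ)).mul this.hasDerivAt).deriv
    have e2 : deriv T 0 = a 0 / b 0 := by
      refine e.trans ?_
      simp
    rw [e2]
    exact div_ne_zero ha0 hb0
  have hda : AnalyticAt ℂ (fun t => 1 - T t ^ 4 * revQuinticDeriv lam (v t)) 0 :=
    analyticAt_const.sub ((hTa.pow 4).mul hva.revQuinticDeriv)
  have hd0 : 1 - T 0 ^ 4 * revQuinticDeriv lam (v 0) ≠ 0 := by simp [hT0]
  -- Let r be the reversed quintic. Differentiating v = T⁴r(v) gives v' = 4T'v/(T(1 - T⁴r'(v))), and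
  -- dx/(4y³) is -v'vT³/4 dt.
  refine ⟨v, T, fun t => -deriv T t / (1 - T t ^ 4 * revQuinticDeriv lam (v t)), hva, hTa,
    hTa.deriv.neg.div hda hd0, hv0, hT0, hT', div_ne_zero (neg_ne_zero.2 hT') hd0, ?_⟩
  have basic : ∀ᶠ t in 𝓝[≠] (0 : ℂ), v t = T t ^ 4 * revQuintic lam (v t) ∧ T t ≠ 0 ∧ v t ≠ 0 ∧
      γ t = (1 / v t, 1 / (v t * T t)) := by
    filter_upwards [hab, hc, self_mem_nhdsWithin,
      (ha.continuousAt.eventually_ne ha0).filter_mono nhdsWithin_le_nhds,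
      (hb.continuousAt.eventually_ne hb0).filter_mono nhdsWithin_le_nhds] with t e f g ga gb
    have g' : t ≠ 0 := g
    have k1 : v t ≠ 0 := div_ne_zero (pow_ne_zero 4 g') ga
    have k2 : T t ≠ 0 := mul_ne_zero g' (div_ne_zero ga gb)
    have k3 : γ t = (1 / v t, 1 / (v t * T t)) := by
      refine Prod.ext ?_ ?_
      · rw [e.1]
        simp only [hv]
        field_simp
      · rw [e.2]
        simp only [hv, hT]
        field_simp
    refine ⟨?_, k2, k1, k3⟩
    rw [curveEq_eq, k3, quintic_eval_one_div lam k1] at f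
    field_simp at f
    linear_combination f
  clear_value v T
  clear hv hT
  -- The relations hold on a full neighbourhood of each nearby t ≠ 0, so they may be differentiated
  -- there.
  filter_upwards [basic, eventually_nhdsNE_eventually_nhds_iff.2 basic, hc,
    hva.eventually_analyticAt.filter_mono nhdsWithin_le_nhds,
    hTa.eventually_analyticAt.filter_mono nhdsWithin_le_nhds,
    (hda.continuousAt.eventually_ne hd0).filter_mono nhdsWithin_le_nhds,
    (hTa.deriv.continuousAt.eventually_ne hT').filter_mono nhdsWithin_le_nhds]
    with t ⟨b1, b2, b3, b4⟩ bn c d e f g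
  have q : revQuintic lam (v t) ≠ 0 := fun q => b3 (by rw [b1, q, mul_zero])
  have hxd : HasDerivAt (fun s => (γ s).1) (-deriv v t / v t ^ 2) t := by
    have := d.differentiableAt.hasDerivAt.inv b3
    refine this.congr_of_eventuallyEq (bn.mono fun s hs => ?_)
    simp [hs.2.2.2, mul_comm]
  have hvd : deriv v t * (1 - T t ^ 4 * revQuinticDeriv lam (v t)) =
      4 * T t ^ 3 * deriv T t * revQuintic lam (v t) := by
    have k := (e.differentiableAt.hasDerivAt.pow 4).mul
      ((hasDerivAt_revQuintic lam (v t)).comp t d.differentiableAt.hasDerivAt)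
    have k' := k.congr_of_eventuallyEq (f₁ := v) (bn.mono fun s hs => hs.1)
    have := k'.deriv
    simp only [Function.comp_apply, Pi.pow_apply] at this
    push_cast at this
    linear_combination this
  have hv' : deriv v t ≠ 0 := by
    intro h0
    rw [h0, zero_mul, eq_comm] at hvd
    simp [b2, g, q] at hvd
  refine ⟨b1, b2, b3, b4, ?_, ?_, ?_, ?_, ?_, c⟩
  · rw [hxd.deriv, b4]
    have key : deriv v t * T t * (1 - T t ^ 4 * revQuinticDeriv lam (v t)) =
        4 * deriv T t * v t := by
      linear_combination T t * hvd - 4 * deriv T t * b1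
    generalize 1 - T t ^ 4 * revQuinticDeriv lam (v t) = D at *
    have hv2 : deriv v t = 4 * deriv T t * v t / (T t * D) := by
      rw [eq_div_iff (mul_ne_zero b2 f)]
      linear_combination key
    rw [hv2]
    field_simp
  · have : AnalyticAt ℂ (fun s => (v s)⁻¹) t := d.inv b3
    refine this.congr (bn.mono fun s hs => ?_)
    simp [hs.2.2.2, mul_comm]
  · have : ContinuousAt (fun s => (v s * T s)⁻¹) t :=
      (d.continuousAt.mul e.continuousAt).inv₀ (mul_ne_zero b3 b2)
    refine this.congr (bn.mono fun s hs => ?_)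
    simp [hs.2.2.2, mul_comm]
  · rw [hxd.deriv]
    exact div_ne_zero (neg_ne_zero.2 hv') (pow_ne_zero 2 b3)
  · rw [b4]
    exact one_div_ne_zero (mul_ne_zero b3 b2)

/-! ### Poles of the differentials dr_j -/

theorem pullback_sum_drCoeff (lam : Fin 5 → ℂ) (c : Fin 6 → ℂ) (γ : ℂ → ℂ × ℂ) (t : ℂ) :
    pullback (fun Q => ∑ j, c j * drCoeff lam j Q) γ t =
      (∑ j, c j * hNum lam j (γ t)) * (deriv (fun s => (γ s).1) t / (4 * (γ t).2 ^ 3)) := by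
  simp only [pullback, drCoeff, Finset.sum_mul]
  refine Finset.sum_congr rfl fun j _ => ?_
  ring

theorem isHolomorphicDiffAt_affine {lam : Fin 5 → ℂ} (hns : IsNonsingular lam) (c : Fin 6 → ℂ)
    (P : ℂ × ℂ) (hP : curveEq lam P = 0) :
    IsHolomorphicDiffAt lam (fun Q => ∑ j, c j * drCoeff lam j Q) (.affine P hP) := by
  intro γ h
  obtain ⟨hreg, ω, hω, hω'⟩ := h.exists_affine_form hns
  have hx : AnalyticAt ℂ (fun s => (γ s).1) 0 := analyticAt_fst.comp h.1
  have hy : AnalyticAt ℂ (fun s => (γ s).2) 0 := analyticAt_snd.comp h.1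
  refine ⟨fun t => (∑ j, c j * hNum lam j (γ t)) * ω t, ?_, ?_⟩
  · refine AnalyticAt.mul ?_ hω
    simp only [Fin.sum_univ_six, hNum]
    simp only [Matrix.cons_val]
    fun_prop
  · filter_upwards [hreg, hω'.filter_mono nhdsWithin_le_nhds] with t a b
    rw [pullback_sum_drCoeff, b a.2.2.2.1]

/-- Near infinity `dr_j` is `T ^ (drExponent j - 12)` times a holomorphic unit. -/
def drExponent : Fin 6 → ℕ := ![0, 4, 5, 8, 9, 10]

/-- The unit factor of `dr_j` near infinity. -/
noncomputable def drUnit (lam : Fin 5 → ℂ) (j : Fin 6) (v : ℂ) : ℂ :=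
  ![(11 + 8 * lam 4 * v + 5 * lam 3 * v ^ 2 + 2 * lam 2 * v ^ 3) / revQuintic lam v ^ 3,
    (7 + 4 * lam 4 * v + lam 3 * v ^ 2) / revQuintic lam v ^ 2,
    2 * (3 + 2 * lam 4 * v + lam 3 * v ^ 2) / revQuintic lam v ^ 2,
    3 / revQuintic lam v, 2 / revQuintic lam v, 1 / revQuintic lam v] j

theorem hNum_infinity (lam : Fin 5 → ℂ) {v T : ℂ} (hT : T ≠ 0) (hv0 : v ≠ 0)
    (hv : v = T ^ 4 * revQuintic lam v) (j : Fin 6) :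
    hNum lam j (1 / v, 1 / (v * T)) * (T ^ 2 * v ^ 2) * T ^ 12 =
      T ^ drExponent j * drUnit lam j v := by
  have hq : revQuintic lam v = v / T ^ 4 := by
    rw [eq_div_iff (pow_ne_zero 4 hT)]
    linear_combination -hv
  fin_cases j <;> simp [hNum, drExponent, drUnit, hq] <;> field_simp

/-- The exponents `drExponent` increase strictly and stay below 12, so the least index j with c j ≠
0 determines the order of the pole. -/
theorem hasPoleDiffAt_infinity (lam : Fin 5 → ℂ) (c : Fin 6 → ℂ) (hc : c ≠ 0) :
    HasPoleDiffAt lam (fun Q => ∑ j, c j * drCoeff lam j Q) .infinity := by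
  intro γ h
  obtain ⟨v, T, ω, hva, hTa, hωa, hv0, hT0, hT', hω0, hev⟩ := h.exists_infinity_coordinates
  obtain ⟨j, hj, hmin⟩ := wellFounded_lt.has_min {j | c j ≠ 0} (Function.ne_iff.1 hc)
  have hmin' (i : Fin 6) (hi : i < j) : c i = 0 := by
    by_contra h0
    exact hmin i h0 hi
  have hmono : StrictMono drExponent := by decide
  have hq0 : revQuintic lam (v 0) ≠ 0 := by simp [hv0, revQuintic_zero]
  have hqa := hva.revQuintic (lam := lam)
  set G : ℂ → ℂ := fun t =>
    (∑ i, c i * (T t ^ (drExponent i - drExponent j) * drUnit lam i (v t))) * ω t with hG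
  have hunit (i : Fin 6) : AnalyticAt ℂ (fun t => drUnit lam i (v t)) 0 := by
    fin_cases i <;> simp only [drUnit, Fin.zero_eta, Fin.mk_one, Fin.reduceFinMk,
      Matrix.cons_val] <;> fun_prop (disch := simpa using hq0)
  have hGa : AnalyticAt ℂ G 0 := by
    refine AnalyticAt.mul (Finset.analyticAt_fun_sum _ fun i _ => ?_) hωa
    exact analyticAt_const.mul ((hTa.pow _).mul (hunit i))
  have hG0 : G 0 ≠ 0 := by
    have : G 0 = c j * drUnit lam j 0 * ω 0 := by
      simp only [hG]
      rw [Finset.sum_eq_single j]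
      · simp [hv0]
      · intro i _ hij
        rcases lt_or_gt_of_ne hij with hlt | hgt
        · rw [hmin' i hlt, zero_mul]
        · have := Nat.sub_ne_zero_of_lt (hmono hgt)
          simp [hT0, this]
      · simp
    rw [this]
    refine mul_ne_zero (mul_ne_zero hj ?_) hω0
    fin_cases j <;> simp [drUnit, revQuintic_zero]
  -- T is t times the unit `dslope T 0`, which turns orders in T into orders in t.
  have hτa : AnalyticAt ℂ (dslope T 0) 0 := by
    obtain ⟨p, hp⟩ := hTa
    exact hp.has_fpower_series_dslope_fslope.analyticAt
  have hτ0 : dslope T 0 0 ≠ 0 := by rwa [dslope_same]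
  set n : ℤ := drExponent j - 12 with hn
  have key : ∀ᶠ t in 𝓝[≠] (0 : ℂ), pullback (fun Q => ∑ j, c j * drCoeff lam j Q) γ t =
      (t - 0) ^ n • (dslope T 0 t ^ n * G t) := by
    filter_upwards [hev] with t ⟨e1, e2, e3, e4, e5, _⟩
    have hTt : T t = (t - 0) * dslope T 0 t := by
      have := sub_smul_dslope T 0 t
      rw [smul_eq_mul, hT0] at this
      rw [this, sub_zero]
    rw [smul_eq_mul, ← mul_assoc, ← mul_zpow, ← hTt, hn, zpow_sub₀ e2, zpow_natCast,
      pullback_sum_drCoeff, e5, e4]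
    norm_cast
    rw [div_mul_eq_mul_div, eq_div_iff (pow_ne_zero 12 e2)]
    simp only [hG, Finset.sum_mul, Finset.mul_sum]
    refine Finset.sum_congr rfl fun i _ => ?_
    rcases lt_or_ge i j with hlt | hge
    · simp [hmin' i hlt]
    · have h1 := hNum_infinity lam e2 e3 e1 i
      have h2 : T t ^ drExponent i = T t ^ drExponent j * T t ^ (drExponent i - drExponent j) := by
        rw [← pow_add, Nat.add_sub_cancel' (hmono.monotone hge)]
      rw [h2] at h1
      linear_combination c i * ω t * h1
  have hga : AnalyticAt ℂ (fun t => dslope T 0 t ^ n * G t) 0 := (hτa.zpow hτ0).mul hGa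
  have hmer : MeromorphicAt (pullback (fun Q => ∑ j, c j * drCoeff lam j Q) γ) 0 := by
    refine MeromorphicAt.congr (f := fun t => (t - 0) ^ n • (dslope T 0 t ^ n * G t)) ?_
      (key.mono fun _ ht => ht.symm)
    exact (((MeromorphicAt.id 0).sub (MeromorphicAt.const 0 0)).zpow n).smul hga.meromorphicAt
  refine ⟨hmer, ?_⟩
  rw [(meromorphicOrderAt_eq_int_iff hmer).2
    ⟨_, hga, mul_ne_zero (zpow_ne_zero n hτ0) hG0, key⟩]
  have : n < 0 := by
    rw [hn]
    fin_cases j <;> simp [drExponent]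
  exact_mod_cast this

/-! ### Regularity off the diagonal -/

section Analyticity

variable {E : Type*} [NormedAddCommGroup E] [NormedSpace ℂ E] {x y z w : E → ℂ} {e : E}

theorem AnalyticAt.polyF (lam : Fin 5 → ℂ) (hx : AnalyticAt ℂ x e) (hy : AnalyticAt ℂ y e)
    (hz : AnalyticAt ℂ z e) (hw : AnalyticAt ℂ w e) :
    AnalyticAt ℂ (fun a => polyF lam (x a, y a) (z a, w a)) e := by
  simp only [_root_.polyF]
  fun_prop

theorem AnalyticAt.quinticDiff (lam : Fin 5 → ℂ) (hx : AnalyticAt ℂ x e)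
    (hz : AnalyticAt ℂ z e) : AnalyticAt ℂ (fun a => quinticDiff lam (x a) (z a)) e := by
  simp only [_root_.quinticDiff]
  fun_prop

theorem AnalyticAt.numY (lam : Fin 5 → ℂ) (hx : AnalyticAt ℂ x e) (hy : AnalyticAt ℂ y e)
    (hz : AnalyticAt ℂ z e) (hw : AnalyticAt ℂ w e) :
    AnalyticAt ℂ (fun a => numY lam (x a, y a) (z a, w a)) e := by
  have h := hx.quinticDiff lam hz
  simp only [_root_.numY, quinticDiff₂, ghSum, Fin.sum_univ_six, gNum, hNum,
    quintic_derivative_eval]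
  simp only [Matrix.cons_val]
  fun_prop

theorem AnalyticAt.numInfinity (lam : Fin 5 → ℂ) (hx : AnalyticAt ℂ x e) (hy : AnalyticAt ℂ y e)
    (hz : AnalyticAt ℂ z e) (hw : AnalyticAt ℂ w e) :
    AnalyticAt ℂ (fun a => numInfinity lam (x a) (y a) (z a) (w a)) e := by
  have h1 := hz.revQuintic (lam := lam)
  have h2 := hz.revQuinticDeriv (lam := lam)
  simp only [_root_.numInfinity, revQuinticDiff₂]
  fun_prop

end Analyticity

/-- The polynomial `T²v⁴F((x,y),(z,w))`, where `z = 1 / v` and `w = 1 / (vT)`. -/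
noncomputable def numMixed (lam : Fin 5 → ℂ) (x y v T : ℂ) : ℂ :=
  4 * y ^ 3 * (T ^ 3 * revQuintic lam v) +
    y ^ 2 * T ^ 2 * (3 * x + lam 3 * v + x ^ 2 * v + 2 * lam 2 * v ^ 2 + 3 * lam 3 * x * v ^ 2 +
      4 * lam 4 * x * v + 4 * lam 0 * v ^ 4 + lam 1 * x * v ^ 4 + 2 * lam 2 * x * v ^ 3 +
      3 * lam 1 * v ^ 3) +
    y * T * (2 * lam 1 * v ^ 2 + 4 * lam 2 * x * v ^ 2 + 4 * lam 0 * v ^ 3 + 2 * lam 1 * x * v ^ 3 +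
      4 * lam 4 * x ^ 2 * v + 2 * lam 3 * x ^ 2 * v ^ 2 + 2 * x ^ 3 * v + 2 * x ^ 2 +
      2 * lam 3 * x * v) +
    (lam 3 * x ^ 3 * v ^ 2 + 4 * lam 0 * v ^ 2 + 3 * lam 1 * x * v ^ 2 + 2 * lam 2 * x ^ 2 * v ^ 2 +
      lam 1 * v + x ^ 3 + 3 * x ^ 4 * v + 2 * lam 2 * x * v + 3 * lam 3 * x ^ 2 * v +
      4 * lam 4 * x ^ 3 * v)

/-- The factor T²v² comes from dz/(4w³) and v² from (x - 1/v)². The one term of F with w³ leaves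
v/T, which is made polynomial by v = T⁴r(v), r being the reversed quintic. -/
theorem polyF_mixed (lam : Fin 5 → ℂ) (x y : ℂ) {v T : ℂ} (hT : T ≠ 0) (hv0 : v ≠ 0)
    (hv : v = T ^ 4 * revQuintic lam v) :
    polyF lam (x, y) (1 / v, 1 / (v * T)) * (T ^ 2 * v ^ 4) = numMixed lam x y v T := by
  have hq : T ^ 3 * revQuintic lam v = v / T := by
    rw [eq_div_iff hT]
    linear_combination -hv
  simp only [polyF, numMixed, hq]
  field_simp

theorem AnalyticAt.numMixed (lam : Fin 5 → ℂ) {E : Type*} [NormedAddCommGroup E]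
    [NormedSpace ℂ E] {x y v T : E → ℂ} {e : E} (hx : AnalyticAt ℂ x e) (hy : AnalyticAt ℂ y e)
    (hv : AnalyticAt ℂ v e) (hT : AnalyticAt ℂ T e) :
    AnalyticAt ℂ (fun a => numMixed lam (x a) (y a) (v a) (T a)) e := by
  have := hv.revQuintic (lam := lam)
  simp only [_root_.numMixed]
  fun_prop

theorem eventually_fst {p : ℂ → Prop} (h : ∀ᶠ t in 𝓝 0, p t) :
    ∀ᶠ u in 𝓝 ((0, 0) : ℂ × ℂ), p u.1 :=
  continuous_fst.continuousAt.eventually h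

theorem eventually_snd {p : ℂ → Prop} (h : ∀ᶠ t in 𝓝 0, p t) :
    ∀ᶠ u in 𝓝 ((0, 0) : ℂ × ℂ), p u.2 :=
  continuous_snd.continuousAt.eventually h

theorem eventually_fst_of_ne {p : ℂ → Prop} (h : ∀ᶠ t in 𝓝[≠] 0, p t) :
    ∀ᶠ u in 𝓝 ((0, 0) : ℂ × ℂ), u.1 ≠ 0 → p u.1 :=
  eventually_fst (eventually_nhdsWithin_iff.1 h)

theorem eventually_snd_of_ne {p : ℂ → Prop} (h : ∀ᶠ t in 𝓝[≠] 0, p t) :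
    ∀ᶠ u in 𝓝 ((0, 0) : ℂ × ℂ), u.2 ≠ 0 → p u.2 :=
  eventually_snd (eventually_nhdsWithin_iff.1 h)

theorem AnalyticAt.comp_fst {g : ℂ → ℂ} (hg : AnalyticAt ℂ g 0) :
    AnalyticAt ℂ (fun u : ℂ × ℂ => g u.1) (0, 0) := hg.comp_of_eq analyticAt_fst rfl

theorem AnalyticAt.comp_snd {g : ℂ → ℂ} (hg : AnalyticAt ℂ g 0) :
    AnalyticAt ℂ (fun u : ℂ × ℂ => g u.2) (0, 0) := hg.comp_of_eq analyticAt_snd rfl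

/-- The form `Ω` is regular near the pair of points with parametrisations `γ` and `δ`. -/
def IsRegularNear (lam : Fin 5 → ℂ) (γ δ : ℂ → ℂ × ℂ) : Prop :=
  ∃ H : ℂ × ℂ → ℂ, AnalyticAt ℂ H (0, 0) ∧ ∀ᶠ u : ℂ × ℂ in 𝓝 (0, 0),
    u.1 ≠ 0 → u.2 ≠ 0 → Generic (γ u.1) (δ u.2) →
      pullback₂ (coeffR lam) γ δ u.1 u.2 = H u

theorem isRegularNear_affine_affine {lam : Fin 5 → ℂ} (hns : IsNonsingular lam) {P Q : ℂ × ℂ}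
    {hP : curveEq lam P = 0} {hQ : curveEq lam Q = 0} (hPQ : P ≠ Q) {γ δ : ℂ → ℂ × ℂ}
    (hγ : IsLocalParam lam (.affine P hP) γ) (hδ : IsLocalParam lam (.affine Q hQ) δ) :
    IsRegularNear lam γ δ := by
  obtain ⟨-, ω, hω, hω'⟩ := hγ.exists_affine_form hns
  obtain ⟨-, ρ, hρ, hρ'⟩ := hδ.exists_affine_form hns
  obtain ⟨hγa, hγ0, -, hγc⟩ := hγ
  obtain ⟨hδa, hδ0, -, hδc⟩ := hδ
  have hx : AnalyticAt ℂ (fun u : ℂ × ℂ => (γ u.1).1) (0, 0) :=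
    AnalyticAt.comp_fst (g := fun t => (γ t).1) (analyticAt_fst.comp hγa)
  have hy : AnalyticAt ℂ (fun u : ℂ × ℂ => (γ u.1).2) (0, 0) :=
    AnalyticAt.comp_fst (g := fun t => (γ t).2) (analyticAt_snd.comp hγa)
  have hz : AnalyticAt ℂ (fun u : ℂ × ℂ => (δ u.2).1) (0, 0) :=
    AnalyticAt.comp_snd (g := fun t => (δ t).1) (analyticAt_fst.comp hδa)
  have hw : AnalyticAt ℂ (fun u : ℂ × ℂ => (δ u.2).2) (0, 0) :=
    AnalyticAt.comp_snd (g := fun t => (δ t).2) (analyticAt_snd.comp hδa)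
  -- Distinct points over the same x have y ≠ w, so the denominator (y - w)² serves there.
  by_cases h1 : P.1 = Q.1
  · have h2 : P.2 - Q.2 ≠ 0 := fun h => hPQ (Prod.ext h1 (sub_eq_zero.1 h))
    have h3 : (γ ((0, 0) : ℂ × ℂ).1).2 - (δ ((0, 0) : ℂ × ℂ).2).2 ≠ 0 := by rwa [hγ0, hδ0]
    refine ⟨fun u => numY lam (γ u.1) (δ u.2) / ((γ u.1).2 - (δ u.2).2) ^ 2 * ω u.1 * ρ u.2,
      (((hx.numY lam hy hz hw).div ((hy.sub hw).pow 2) (pow_ne_zero 2 h3)).mul hω.comp_fst).mul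
        hρ.comp_snd, ?_⟩
    filter_upwards [eventually_fst hγc, eventually_snd hδc, eventually_fst hω', eventually_snd hρ',
      (hy.sub hw).continuousAt.eventually_ne h3] with u a b c d e _ _ g
    have e' : (γ u.1).2 - (δ u.2).2 ≠ 0 := e
    rw [pullback₂_eq lam γ δ b g, c g.2.1, d g.2.2]
    congr 2
    rw [div_eq_div_iff (pow_ne_zero 2 (sub_ne_zero.2 g.1)) (pow_ne_zero 2 e')]
    linear_combination polyF_mul_sq lam a b
  · have h3 : (γ ((0, 0) : ℂ × ℂ).1).1 - (δ ((0, 0) : ℂ × ℂ).2).1 ≠ 0 := by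
      rw [hγ0, hδ0]
      exact sub_ne_zero.2 h1
    refine ⟨fun u => polyF lam (γ u.1) (δ u.2) / ((γ u.1).1 - (δ u.2).1) ^ 2 * ω u.1 * ρ u.2,
      (((hx.polyF lam hy hz hw).div ((hx.sub hz).pow 2) (pow_ne_zero 2 h3)).mul hω.comp_fst).mul
        hρ.comp_snd, ?_⟩
    filter_upwards [eventually_snd hδc, eventually_fst hω', eventually_snd hρ']
      with u b c d _ _ g
    rw [pullback₂_eq lam γ δ b g, c g.2.1, d g.2.2]

theorem isRegularNear_affine_infinity {lam : Fin 5 → ℂ} (hns : IsNonsingular lam) {P : ℂ × ℂ}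
    {hP : curveEq lam P = 0} {γ δ : ℂ → ℂ × ℂ}
    (hγ : IsLocalParam lam (.affine P hP) γ) (hδ : IsLocalParam lam .infinity δ) :
    IsRegularNear lam γ δ := by
  obtain ⟨-, ω, hω, hω'⟩ := hγ.exists_affine_form hns
  obtain ⟨v, T, ρ, hva, hTa, hρ, hv0, hT0, -, -, hev⟩ := hδ.exists_infinity_coordinates
  obtain ⟨hγa, hγ0, -, hγc⟩ := hγ
  have hx : AnalyticAt ℂ (fun u : ℂ × ℂ => (γ u.1).1) (0, 0) :=
    AnalyticAt.comp_fst (g := fun t => (γ t).1) (analyticAt_fst.comp hγa)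
  have hy : AnalyticAt ℂ (fun u : ℂ × ℂ => (γ u.1).2) (0, 0) :=
    AnalyticAt.comp_fst (g := fun t => (γ t).2) (analyticAt_snd.comp hγa)
  have hv := hva.comp_snd
  have hT := hTa.comp_snd
  have hn := hx.numMixed lam hy hv hT
  -- After scaling by v the denominator x - 1/v becomes xv - 1, which is -1 at infinity.
  have h3 : (γ ((0, 0) : ℂ × ℂ).1).1 * v ((0, 0) : ℂ × ℂ).2 - 1 ≠ 0 := by simp [hv0]
  refine ⟨fun u => numMixed lam (γ u.1).1 (γ u.1).2 (v u.2) (T u.2) /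
    ((γ u.1).1 * v u.2 - 1) ^ 2 * ω u.1 * ρ u.2,
    ((hn.div (((hx.mul hv).sub analyticAt_const).pow 2) (pow_ne_zero 2 h3)).mul hω.comp_fst).mul
      hρ.comp_snd, ?_⟩
  filter_upwards [eventually_fst hω', eventually_snd_of_ne hev,
    ((hx.mul hv).sub analyticAt_const).continuousAt.eventually_ne h3] with u a b c _ u0 g
  obtain ⟨b1, b2, b3, b4, b5, b6⟩ := b u0
  have c' : (γ u.1).1 * v u.2 - 1 ≠ 0 := c
  rw [pullback₂_eq lam γ δ b6.2.2.2.2 g, a g.2.1, b5, b4,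
    ← polyF_mixed lam (γ u.1).1 (γ u.1).2 b2 b3 b1]
  have h4 : (γ u.1).1 - 1 / v u.2 = ((γ u.1).1 * v u.2 - 1) / v u.2 := by
    field_simp
  simp only [h4, Prod.mk.eta]
  field_simp

theorem IsRegularNear.symm {lam : Fin 5 → ℂ} {γ δ : ℂ → ℂ × ℂ} (h : IsRegularNear lam γ δ)
    (hγ : ∀ᶠ t in 𝓝[≠] (0 : ℂ), curveEq lam (γ t) = 0)
    (hδ : ∀ᶠ t in 𝓝[≠] (0 : ℂ), curveEq lam (δ t) = 0) : IsRegularNear lam δ γ := by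
  obtain ⟨H, hH, h⟩ := h
  refine ⟨fun u => H (u.2, u.1), hH.comp_of_eq (analyticAt_snd.prod analyticAt_fst) rfl, ?_⟩
  have t : Tendsto (fun u : ℂ × ℂ => (u.2, u.1)) (𝓝 (0, 0)) (𝓝 (0, 0)) :=
    continuous_swap.tendsto' _ _ rfl
  filter_upwards [t.eventually h, eventually_fst_of_ne hδ, eventually_snd_of_ne hγ]
    with u a b c u1 u2 g
  rw [pullback₂_symm lam δ γ (b u1) (c u2) g, a u2 u1 g.symm]

theorem IsLocalParam.eventually_curveEq {lam : Fin 5 → ℂ} {p : CurvePoint lam} {γ : ℂ → ℂ × ℂ}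
    (h : IsLocalParam lam p γ) : ∀ᶠ t in 𝓝[≠] (0 : ℂ), curveEq lam (γ t) = 0 := by
  cases p with
  | affine P hP => exact h.2.2.2.filter_mono nhdsWithin_le_nhds
  | infinity => exact h.2.2.2

theorem isRegularNear_of_ne {lam : Fin 5 → ℂ} (hns : IsNonsingular lam) {p q : CurvePoint lam}
    (hpq : p ≠ q) {γ δ : ℂ → ℂ × ℂ} (hγ : IsLocalParam lam p γ) (hδ : IsLocalParam lam q δ) :
    IsRegularNear lam γ δ := by
  cases p with
  | affine P hP =>
    cases q with
    | affine Q hQ =>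
      refine isRegularNear_affine_affine hns (fun h => hpq ?_) hγ hδ
      subst h
      rfl
    | infinity => exact isRegularNear_affine_infinity hns hγ hδ
  | infinity =>
    cases q with
    | affine Q hQ =>
      exact (isRegularNear_affine_infinity hns hδ hγ).symm hδ.eventually_curveEq
        hγ.eventually_curveEq
    | infinity => exact absurd rfl hpq

/-! ### Ω near the diagonal, in the coordinates x, y and T -/

/-- If near a point `Ω` is `A / (g - g')²` times a product of holomorphic differentials, where `g`
is a local coordinate, then `Ω` has the diagonal behaviour required there. -/
theorem exists_diagonal_remainder_of_coordinate {lam : Fin 5 → ℂ} {γ : ℂ → ℂ × ℂ}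
    (hreg : ∀ᶠ t in 𝓝[≠] (0 : ℂ), RegularAt lam γ t) {g ω : ℂ → ℂ} {A : ℂ × ℂ → ℂ}
    (hg : AnalyticAt ℂ g 0) (hg' : deriv g 0 ≠ 0) (hω : AnalyticAt ℂ ω 0)
    (hA : AnalyticAt ℂ A (0, 0))
    (h : ∀ᶠ u in 𝓝 ((0, 0) : ℂ × ℂ), u.1 ≠ 0 → u.2 ≠ 0 → Generic (γ u.1) (γ u.2) →
      pullback₂ (coeffR lam) γ γ u.1 u.2 = A u / (g u.1 - g u.2) ^ 2 * ω u.1 * ω u.2) :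
    ∃ H : ℂ × ℂ → ℂ, AnalyticAt ℂ H (0, 0) ∧ ∀ᶠ u : ℂ × ℂ in 𝓝 (0, 0),
      u.1 ≠ 0 → u.2 ≠ 0 → Generic (γ u.1) (γ u.2) →
        pullback₂ (coeffR lam) γ γ u.1 u.2 = 1 / (u.1 - u.2) ^ 2 + H u := by
  obtain ⟨X, hX, hX0, hgX⟩ := hg.exists_divided_difference
  rw [← hX0] at hg'
  refine exists_diagonal_remainder hreg
    (((hA.div (hX.pow 2) (pow_ne_zero 2 hg')).mul hω.comp_fst).mul hω.comp_snd) ?_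
  filter_upwards [h, hgX, hX.continuousAt.eventually_ne hg'] with u a b c u1 u2 hG
  have h4 : u.1 - u.2 ≠ 0 := fun e => hG.1 (by rw [sub_eq_zero.1 e])
  rw [a u1 u2 hG, b]
  simp only [Pi.mul_apply, Pi.div_apply, Pi.pow_apply]
  field_simp

theorem exists_diagonal_remainder_affine {lam : Fin 5 → ℂ} (hns : IsNonsingular lam) {P : ℂ × ℂ}
    {hP : curveEq lam P = 0} {γ : ℂ → ℂ × ℂ} (hγ : IsLocalParam lam (.affine P hP) γ) :
    ∃ H : ℂ × ℂ → ℂ, AnalyticAt ℂ H (0, 0) ∧ ∀ᶠ u : ℂ × ℂ in 𝓝 (0, 0),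
      u.1 ≠ 0 → u.2 ≠ 0 → Generic (γ u.1) (γ u.2) →
        pullback₂ (coeffR lam) γ γ u.1 u.2 = 1 / (u.1 - u.2) ^ 2 + H u := by
  obtain ⟨hreg, ω, hω, hω'⟩ := hγ.exists_affine_form hns
  have hx' : AnalyticAt ℂ (fun t => (γ t).1) 0 := analyticAt_fst.comp hγ.1
  have hy' : AnalyticAt ℂ (fun t => (γ t).2) 0 := analyticAt_snd.comp hγ.1
  have hx := hx'.comp_fst
  have hy := hy'.comp_fst
  have hz := hx'.comp_snd
  have hw := hy'.comp_snd
  have hγ0 := hγ.2.1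
  have hγc := hγ.2.2.2
  by_cases h0 : P.2 = 0
  · refine exists_diagonal_remainder_of_coordinate hreg hy' (hγ.deriv_snd_ne_zero hns h0) hω
      (hx.numY lam hy hz hw) ?_
    have hD0 : quinticDiff lam (γ ((0, 0) : ℂ × ℂ).1).1 (γ ((0, 0) : ℂ × ℂ).2).1 ≠ 0 := by
      rw [quinticDiff_self, hγ0]
      exact quintic_derivative_eval_ne_zero hns hP h0
    filter_upwards [eventually_fst hγc, eventually_snd hγc, eventually_fst hω', eventually_snd hω',
      (hx.quinticDiff lam hz).continuousAt.eventually_ne hD0] with u a b c d e _ _ g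
    have hxz := sub_ne_zero.2 g.1
    -- If y = w, then (x - z)D = y⁴ - w⁴ = 0 for the divided difference D of q; D is near q' ≠ 0, so
    -- x = z, against genericity.
    have hyw : (γ u.1).2 - (γ u.2).2 ≠ 0 := by
      intro hyw
      have := pow_four_sub lam a b
      rw [sub_eq_zero.1 hyw, sub_self, eq_comm, mul_eq_zero] at this
      exact this.elim hxz e
    rw [pullback₂_eq lam γ γ b g, c g.2.1, d g.2.2]
    congr 2
    rw [div_eq_div_iff (pow_ne_zero 2 hxz) (pow_ne_zero 2 hyw)]
    linear_combination polyF_mul_sq lam a b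
  · refine exists_diagonal_remainder_of_coordinate hreg hx' (hγ.deriv_fst_ne_zero h0) hω
      (hx.polyF lam hy hz hw) ?_
    filter_upwards [eventually_snd hγc, eventually_fst hω', eventually_snd hω'] with u b c d _ _ g
    rw [pullback₂_eq lam γ γ b g, c g.2.1, d g.2.2]

theorem exists_diagonal_remainder_infinity {lam : Fin 5 → ℂ} {γ : ℂ → ℂ × ℂ}
    (hγ : IsLocalParam lam .infinity γ) :
    ∃ H : ℂ × ℂ → ℂ, AnalyticAt ℂ H (0, 0) ∧ ∀ᶠ u : ℂ × ℂ in 𝓝 (0, 0),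
      u.1 ≠ 0 → u.2 ≠ 0 → Generic (γ u.1) (γ u.2) →
        pullback₂ (coeffR lam) γ γ u.1 u.2 = 1 / (u.1 - u.2) ^ 2 + H u := by
  obtain ⟨v, T, ω, hva, hTa, hω, hv0, hT0, hT', -, hev⟩ := hγ.exists_infinity_coordinates
  have hA := hva.comp_fst.numInfinity lam hTa.comp_fst hva.comp_snd hTa.comp_snd
  refine exists_diagonal_remainder_of_coordinate (hev.mono fun t ht => ht.2.2.2.2.2) hTa hT' hω
    hA ?_
  -- The numerator is 1 at the origin. Being nonzero nearby, it excludes T = U when v ≠ u, by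
  -- `polyF_infinity`.
  have hA0 : numInfinity lam (v ((0, 0) : ℂ × ℂ).1) (T ((0, 0) : ℂ × ℂ).1)
      (v ((0, 0) : ℂ × ℂ).2) (T ((0, 0) : ℂ × ℂ).2) ≠ 0 := by
    simp [numInfinity, hT0]
  filter_upwards [eventually_fst_of_ne hev, eventually_snd_of_ne hev,
    hA.continuousAt.eventually_ne hA0] with u a b c u1 u2 g
  obtain ⟨a1, a2, a3, a4, a5, a6⟩ := a u1
  obtain ⟨b1, b2, b3, b4, b5, b6⟩ := b u2
  have key := polyF_infinity lam a2 b2 a3 b3 a1 b1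
  have hvu : v u.1 - v u.2 ≠ 0 := by
    intro e
    apply g.1
    rw [a4, b4, sub_eq_zero.1 e]
  have hTU : T u.1 - T u.2 ≠ 0 := by
    intro e
    rw [e] at key
    simp [hvu] at key
    exact c key
  rw [pullback₂_eq lam γ γ b6.2.2.2.2 g, a5, b5, a4, b4]
  have e1 : 1 / v u.1 - 1 / v u.2 = -(v u.1 - v u.2) / (v u.1 * v u.2) := by
    field_simp
    ring
  simp only [e1]
  rw [show ∀ F : ℂ, F / (-(v u.1 - v u.2) / (v u.1 * v u.2)) ^ 2 *
      (ω u.1 * (T u.1 ^ 2 * v u.1 ^ 2)) * (ω u.2 * (T u.2 ^ 2 * v u.2 ^ 2)) =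
      F * (T u.1 ^ 2 * T u.2 ^ 2 * v u.1 ^ 4 * v u.2 ^ 4) / (v u.1 - v u.2) ^ 2 *
        ω u.1 * ω u.2 from fun F => by field_simp]
  congr 2
  rw [div_eq_div_iff (pow_ne_zero 2 hvu) (pow_ne_zero 2 hTU), key]
  ring

theorem isFundamentalDifferential_coeffR {lam : Fin 5 → ℂ} (hns : IsNonsingular lam) :
    IsFundamentalDifferential lam (coeffR lam) where
  symmetric P Q hP hQ h := by
    rw [coeffR_eq_polyF lam hQ h, coeffR_eq_polyF lam hP h.symm, polyF_symm lam P Q]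
    congr 1
    ring
  offDiagonal _ _ hpq _ _ hγ hδ := isRegularNear_of_ne hns hpq hγ hδ
  diagonal p _ hγ := by
    cases p with
    | affine P hP => exact exists_diagonal_remainder_affine hns hγ
    | infinity => exact exists_diagonal_remainder_infinity hγ

theorem mainTheorem10 (lam : Fin 5 → ℂ) (hns : IsNonsingular lam) :
    -- the `dr_j` have their only pole at infinity, and no nontrivial linear combination of them
    -- is holomorphic
    (∀ c : Fin 6 → ℂ,
      ∀ (P : ℂ × ℂ) (hP : curveEq lam P = 0),
        IsHolomorphicDiffAt lam (fun Q => ∑ j, c j * drCoeff lam j Q) (.affine P hP)) ∧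
    (∀ c : Fin 6 → ℂ, c ≠ 0 →
        HasPoleDiffAt lam (fun Q => ∑ j, c j * drCoeff lam j Q) .infinity) ∧
    -- `Ω = R dx dz` is a fundamental differential of the second kind
    IsFundamentalDifferential lam (coeffR lam) ∧
    -- the polynomial `F` is symmetric
    (∀ P Q : ℂ × ℂ, polyF lam P Q = polyF lam Q P) ∧
    -- `Ω = F dx dz / ((x - z)² f_y f_w)`
    (∀ P Q : ℂ × ℂ, curveEq lam P = 0 → curveEq lam Q = 0 → Generic P Q →
      coeffR lam P Q = polyF lam P Q / ((P.1 - Q.1) ^ 2 * curveEqY lam P * curveEqY lam Q)) :=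
  ⟨fun c P hP => isHolomorphicDiffAt_affine hns c P hP, hasPoleDiffAt_infinity lam,
    isFundamentalDifferential_coeffR hns, polyF_symm lam,
    fun _ _ _ hQ h => coeffR_eq_polyF lam hQ h⟩
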